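/- Let $A\to M$ be a Lie algebroid over a smooth manifold, with anchor $\rho$, and let $I=[0,1]$. An $A$-path from $x$ to $y$ is a (smooth) Lie algebroid morphism $a\,dt:TI\to A$ whose base path goes from $x$ to $y$. An $A$-homotopy $\sigma:a_0\Rightarrow a_1$ between two $A$-paths from $x$ to $y$ is a Lie algebroid morphism $\sigma=a\,dt+b\,ds:TI^2\to A$ with $a\,dt|_{s=0}=a_0\,dt$, $a\,dt|_{s=1}=a_1\,dt$ and $b|_{t=0,1}=0$; it is thin if $\wedge^2\sigma=0$, i.e. $a\wedge b=0$ everywhere. A $3$-homotopy between $A$-homotopies $\sigma_0,\sigma_1$ is a Lie algebroid morphism $H=H_1dt+H_2ds+H_3du:TI^3\to A$ with $H_3=0$ for $t=0,1$ and for $s=0,1$, and with $(H_1dt+H_2ds)|_{u=0}=\sigma_0$, $(H_1dt+H_2ds)|_{u=1}=\sigma_1$. Then thin homotopy, $A$-homotopy and $3$-homotopy are equivalence relations. Let $P_1(A)$ be the set of thin homotopy classes of $A$-paths (the $1$-morphisms of the Weinstein $2$-groupoid of $A$), $P_2(A)$ the set of $3$-homotopy classes of $A$-homotopies (its $2$-morphisms),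 with source and target maps $P_2(A)\rightrightarrows P_1(A)$ induced by $(\sigma:a_0\Rightarrow a_1)\mapsto a_0,a_1$, and $\mathcal G(A)$ the set of $A$-homotopy classes of $A$-paths. Both $P_1(A)$ and $\mathcal G(A)$ (the Weinstein groupoid of $A$) are groupoids over $M$: units are the classes of the zero paths $0_x\,dt$, inverses are given by $a(t)\,dt\mapsto -a(1-t)\,dt$, and the product $[b]\cdot[a]$ is the class of the concatenation of $a$ and $b$, if it is smooth, and in general of the concatenation of their reparametrizations $\tau'(t)\,a(\tau(t))\,dt$ and $\tau'(t)\,b(\tau(t))\,dt$, where $\tau:\mathbb R\to[0,1]$ is any smooth function with $\tau=0$ on $(-\infty,0]$ and $\tau=1$ on $[1,\infty)$. Call two elements of $P_1(A)$ related if there is an element of $P_2(A)$ from one to the other. This is an equivalence relation, the groupoid structure of $P_1(A)$ descends to the orbit space $P_1(A)/P_2(A)$ (the $1$-truncation of the Weinstein $2$-groupoid), and $[[a]]\mapsto[a]$ is a well-defined isomorphism of groupoids over $M$ (the identity on objects) $$P_1(A)/P_2(A)\;\cong\;\mathcal G(A).$$ -/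

import Mathlib

open Bundle Set
open scoped Manifold ContDiff

noncomputable section

namespace Weinstein

universe uE uM uF uA

section Algebroid

variable {E : Type uE} [NormedAddCommGroup E] [NormedSpace ℝ E]
  {M : Type uM} [TopologicalSpace M] [ChartedSpace E M]

/-- The derivative `v(f)` of a real function `f` at `x` along a tangent vector `v`. -/
def dirDeriv (f : M → ℝ) (x : M) (v : TangentSpace 𝓘(ℝ, E) x) : ℝ :=
  mfderiv 𝓘(ℝ, E) 𝓘(ℝ, ℝ) f x v

variable {F : Type uF} [NormedAddCommGroup F] [NormedSpace ℝ F]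
  {A : M → Type uA} [TopologicalSpace (TotalSpace F A)]
  [∀ x, AddCommGroup (A x)] [∀ x, Module ℝ (A x)] [∀ x, TopologicalSpace (A x)]
  [FiberBundle F A] [VectorBundle ℝ F A]

/-- The product `f X` of a smooth function and a smooth section. -/
def funSmul (f : C^∞⟮𝓘(ℝ, E), M; 𝓘(ℝ, ℝ), ℝ⟯) (X : Cₛ^∞⟮𝓘(ℝ, E); F, A⟯) :
    Cₛ^∞⟮𝓘(ℝ, E); F, A⟯ :=
  ⟨fun x => f x • X x, f.contMDiff.smul_section X.contMDiff⟩

variable (E M F A) in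
/-- A Lie algebroid structure on the smooth vector bundle `A → M`: an anchor `ρ : A → TM`
(a smooth section of `Hom(A, TM)`) and a Lie bracket on the space of smooth sections of `A`
which satisfies the Leibniz rule `[X, f Y] = f [X, Y] + (ρ(X) f) Y`. -/
structure LieAlgebroid [IsManifold 𝓘(ℝ, E) ∞ M] where
  anchor : Cₛ^∞⟮𝓘(ℝ, E); F →L[ℝ] E, fun x : M => A x →L[ℝ] TangentSpace 𝓘(ℝ, E) x⟯
  bracket : Cₛ^∞⟮𝓘(ℝ, E); F, A⟯ →ₗ[ℝ] Cₛ^∞⟮𝓘(ℝ, E); F, A⟯ →ₗ[ℝ] Cₛ^∞⟮𝓘(ℝ, E); F, A⟯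
  bracket_self : ∀ X, bracket X X = 0
  jacobi : ∀ X Y Z,
    bracket X (bracket Y Z) + bracket Y (bracket Z X) + bracket Z (bracket X Y) = 0
  leibniz : ∀ (X Y : Cₛ^∞⟮𝓘(ℝ, E); F, A⟯) (f : C^∞⟮𝓘(ℝ, E), M; 𝓘(ℝ, ℝ), ℝ⟯) (x : M),
    bracket X (funSmul f Y) x
      = f x • bracket X Y x + dirDeriv f x (anchor x (X x)) • Y x

variable (E M F A) in
/-- Smooth sections of the dual bundle `A^*`. -/
abbrev DualSection :=
  Cₛ^∞⟮𝓘(ℝ, E); F →L[ℝ] ℝ, fun x : M => A x →L[ℝ] Bundle.Trivial M ℝ x⟯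

/-- The pairing of a section of `A^*` with a vector of `A`. -/
def DualSection.pair (θ : DualSection E M F A) (x : M) (v : A x) : ℝ := θ x v

variable [IsManifold 𝓘(ℝ, E) ∞ M]

/-- The Lie algebroid differential of a 1-form,
`(d_A θ)(X, Y) = ρ(X) θ(Y) - ρ(Y) θ(X) - θ([X, Y])`, at the point `x`. -/
def LieAlgebroid.d (L : LieAlgebroid E M F A) (θ : DualSection E M F A)
    (X Y : Cₛ^∞⟮𝓘(ℝ, E); F, A⟯) (x : M) : ℝ :=
  dirDeriv (fun y => θ.pair y (Y y)) x (L.anchor x (X x))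
    - dirDeriv (fun y => θ.pair y (X y)) x (L.anchor x (Y x))
    - θ.pair x (L.bracket X Y x)

/-- The unit cube `I^n`. -/
def cube (n : ℕ) : Set (Fin n → ℝ) := Icc 0 1

/-- A Lie algebroid morphism `∑ i, a i dt_i : T I^n → A`. It consists of a base map `I^n → M` and
of sections `a i` of `A` along it, smooth up to the boundary of the cube, which are compatible with
the anchors, `ρ (a i) = ∂_i (base)`, and with the differentials,
`∂_i ⟨θ, a j⟩ - ∂_j ⟨θ, a i⟩ = (d_A θ)(a i, a j)` for all 1-forms `θ`, where the right hand side is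
computed with arbitrary sections through the two vectors. (Functions are defined on `ℝ^n` but only
their values on the cube matter.) -/
structure CubeMorphism (L : LieAlgebroid E M F A) (n : ℕ) where
  base : (Fin n → ℝ) → M
  comp : Fin n → ∀ p, A (base p)
  smooth : ∀ i, ContMDiffOn 𝓘(ℝ, Fin n → ℝ) (𝓘(ℝ, E).prod 𝓘(ℝ, F)) ∞
    (fun p => (⟨base p, comp i p⟩ : TotalSpace F A)) (cube n)
  anchor_eq : ∀ i, ∀ p ∈ cube n,
    L.anchor (base p) (comp i p)
      = mfderivWithin 𝓘(ℝ, Fin n → ℝ) 𝓘(ℝ, E) base (cube n) p (Pi.single i (1 : ℝ) : Fin n → ℝ)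
  d_eq : ∀ i j, i < j → ∀ p ∈ cube n, ∀ (θ : DualSection E M F A)
    (X Y : Cₛ^∞⟮𝓘(ℝ, E); F, A⟯), X (base p) = comp i p → Y (base p) = comp j p →
    fderivWithin ℝ (fun q => θ.pair (base q) (comp j q)) (cube n) p (Pi.single i 1)
      - fderivWithin ℝ (fun q => θ.pair (base q) (comp i q)) (cube n) p (Pi.single j 1)
      = L.d θ X Y (base p)

/-- The `i`-th component at `p`, as a point of the total space of `A`. -/
def CubeMorphism.val {L : LieAlgebroid E M F A} {n : ℕ} (σ : CubeMorphism L n) (i : Fin n)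
    (p : Fin n → ℝ) : TotalSpace F A := ⟨σ.base p, σ.comp i p⟩

/-- `A`-paths `a dt : T I → A` from `x` to `y`. -/
structure APath (L : LieAlgebroid E M F A) (x y : M) extends CubeMorphism L 1 where
  base_zero : base ![0] = x
  base_one : base ![1] = y

/-- The point `a(t)` of `A`. -/
def APath.at {L : LieAlgebroid E M F A} {x y : M} (a : APath L x y) (t : ℝ) : TotalSpace F A :=
  a.val 0 ![t]

/-- `A`-homotopies `a dt + b ds : T I^2 → A` between two `A`-paths, in the coordinates `![t, s]`. -/
structure AHomotopy {L : LieAlgebroid E M F A} {x y : M} (a₀ a₁ : APath L x y) extends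
    CubeMorphism L 2 where
  source_eq : ∀ t ∈ Icc (0 : ℝ) 1, toCubeMorphism.val 0 ![t, 0] = a₀.at t
  target_eq : ∀ t ∈ Icc (0 : ℝ) 1, toCubeMorphism.val 0 ![t, 1] = a₁.at t
  b_zero : ∀ s ∈ Icc (0 : ℝ) 1, comp 1 ![0, s] = 0
  b_one : ∀ s ∈ Icc (0 : ℝ) 1, comp 1 ![1, s] = 0

/-- An `A`-homotopy `a dt + b ds` is thin if `a ∧ b = 0` everywhere. -/
def AHomotopy.IsThin {L : LieAlgebroid E M F A} {x y : M} {a₀ a₁ : APath L x y}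
    (σ : AHomotopy a₀ a₁) : Prop :=
  ∀ p ∈ cube 2, ExteriorAlgebra.ι ℝ (σ.comp 0 p) * ExteriorAlgebra.ι ℝ (σ.comp 1 p) = 0

/-- Two `A`-paths are `A`-homotopic. -/
def AHomotopic (L : LieAlgebroid E M F A) {x y : M} (a₀ a₁ : APath L x y) : Prop :=
  Nonempty (AHomotopy a₀ a₁)

/-- Two `A`-paths are thin homotopic. -/
def ThinHomotopic (L : LieAlgebroid E M F A) {x y : M} (a₀ a₁ : APath L x y) : Prop :=
  ∃ σ : AHomotopy a₀ a₁, σ.IsThin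

/-- All `A`-homotopies between `A`-paths from `x` to `y`. -/
structure TotalAHomotopy (L : LieAlgebroid E M F A) (x y : M) where
  src : APath L x y
  tgt : APath L x y
  hom : AHomotopy src tgt

/-- Two `A`-homotopies `σ₀`, `σ₁` are 3-homotopic: there is a Lie algebroid morphism
`H₁ dt + H₂ ds + H₃ du : T I^3 → A`, in the coordinates `![t, s, u]`, with `H₃ = 0` for `t = 0, 1`
and for `s = 0, 1`, which restricts to `σ₀` at `u = 0` and to `σ₁` at `u = 1`. -/
def ThreeHomotopic (L : LieAlgebroid E M F A) {x y : M} (σ₀ σ₁ : TotalAHomotopy L x y) : Prop :=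
  ∃ H : CubeMorphism L 3,
    (∀ s ∈ Icc (0 : ℝ) 1, ∀ u ∈ Icc (0 : ℝ) 1, H.comp 2 ![0, s, u] = 0 ∧ H.comp 2 ![1, s, u] = 0) ∧
    (∀ t ∈ Icc (0 : ℝ) 1, ∀ u ∈ Icc (0 : ℝ) 1, H.comp 2 ![t, 0, u] = 0 ∧ H.comp 2 ![t, 1, u] = 0) ∧
    (∀ t ∈ Icc (0 : ℝ) 1, ∀ s ∈ Icc (0 : ℝ) 1,
      H.val 0 ![t, s, 0] = σ₀.hom.val 0 ![t, s] ∧ H.val 1 ![t, s, 0] = σ₀.hom.val 1 ![t, s]) ∧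
    (∀ t ∈ Icc (0 : ℝ) 1, ∀ s ∈ Icc (0 : ℝ) 1,
      H.val 0 ![t, s, 1] = σ₁.hom.val 0 ![t, s] ∧ H.val 1 ![t, s, 1] = σ₁.hom.val 1 ![t, s])

/-- The 1-morphisms `x → y` of the Weinstein 2-groupoid: thin homotopy classes of `A`-paths. -/
def P₁ (L : LieAlgebroid E M F A) (x y : M) := Quot (ThinHomotopic L (x := x) (y := y))

/-- The 2-morphisms of the Weinstein 2-groupoid with horizontal source `x` and horizontal
target `y`: 3-homotopy classes of `A`-homotopies. -/
def P₂ (L : LieAlgebroid E M F A) (x y : M) := Quot (ThreeHomotopic L (x := x) (y := y))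

/-- The arrows `x → y` of the Weinstein groupoid `G(A)`: `A`-homotopy classes of `A`-paths. -/
def G (L : LieAlgebroid E M F A) (x y : M) := Quot (AHomotopic L (x := x) (y := y))

/-- The thin homotopy class of an `A`-path. -/
def P₁.mk {L : LieAlgebroid E M F A} {x y : M} (a : APath L x y) : P₁ L x y := Quot.mk _ a

/-- The homotopy class of an `A`-path. -/
def G.mk {L : LieAlgebroid E M F A} {x y : M} (a : APath L x y) : G L x y := Quot.mk _ a

/-! The vertical source and target of a 3-homotopy class are well defined: a 3-homotopy restricts
on the faces `s = 0` and `s = 1` to thin homotopies. -/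

lemma uniqueDiffOn_cube (n : ℕ) : UniqueDiffOn ℝ (cube n) := by
  refine uniqueDiffOn_convex (convex_Icc _ _) ⟨fun _ => 1 / 2, ?_⟩
  have : (Set.univ.pi fun _ : Fin n => Ioo (0 : ℝ) 1) ⊆ cube n := fun p hp =>
    ⟨fun i => (hp i trivial).1.le, fun i => (hp i trivial).2.le⟩
  refine interior_maximal this (isOpen_set_pi finite_univ fun _ _ => isOpen_Ioo) ?_
  intro i _
  norm_num

/-- The inclusion of the face `s = c` of the cube with coordinates `![t, s, u]`. -/
def face (c : ℝ) (p : Fin 2 → ℝ) : Fin 3 → ℝ := ![p 0, c, p 1]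

/-- The linear part of `face c`. -/
def faceLin : (Fin 2 → ℝ) →L[ℝ] (Fin 3 → ℝ) :=
  ContinuousLinearMap.pi
    ![ContinuousLinearMap.proj 0, 0, ContinuousLinearMap.proj 1]

lemma hasFDerivAt_face (c : ℝ) (p : Fin 2 → ℝ) : HasFDerivAt (face c) faceLin p := by
  rw [hasFDerivAt_pi']
  intro i
  fin_cases i
  · exact hasFDerivAt_apply (𝕜 := ℝ) (0 : Fin 2) p
  · exact hasFDerivAt_const c p
  · exact hasFDerivAt_apply (𝕜 := ℝ) (1 : Fin 2) p

lemma contDiff_face (c : ℝ) : ContDiff ℝ ∞ (face c) := by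
  rw [contDiff_pi]
  intro i
  fin_cases i
  · exact contDiff_apply ℝ ℝ (0 : Fin 2)
  · exact contDiff_const
  · exact contDiff_apply ℝ ℝ (1 : Fin 2)

lemma mapsTo_face {c : ℝ} (hc : c ∈ Icc (0 : ℝ) 1) : MapsTo (face c) (cube 2) (cube 3) := by
  intro p hp
  refine ⟨fun i => ?_, fun i => ?_⟩
  · fin_cases i
    exacts [hp.1 0, hc.1, hp.1 1]
  · fin_cases i
    exacts [hp.2 0, hc.2, hp.2 1]

/-- The index of the coordinate of the cube which restricts to the given one of the face. -/
def faceIdx : Fin 2 → Fin 3 := ![0, 2]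

lemma faceLin_single (i : Fin 2) : faceLin (Pi.single i 1) = Pi.single (faceIdx i) 1 := by
  funext k
  fin_cases i <;> fin_cases k <;> simp [faceLin, faceIdx]

lemma CubeMorphism.contMDiffOn_base {L : LieAlgebroid E M F A} {n : ℕ} (σ : CubeMorphism L n)
    (i : Fin n) : ContMDiffOn 𝓘(ℝ, Fin n → ℝ) 𝓘(ℝ, E) ∞ σ.base (cube n) := by
  intro p hp
  exact ((contMDiffWithinAt_totalSpace).1 (σ.smooth i p hp)).1

lemma CubeMorphism.differentiableOn_pair [ContMDiffVectorBundle ∞ F A 𝓘(ℝ, E)]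
    {L : LieAlgebroid E M F A} {n : ℕ}
    (σ : CubeMorphism L n) (θ : DualSection E M F A) (i : Fin n) :
    DifferentiableOn ℝ (fun q => θ.pair (σ.base q) (σ.comp i q)) (cube n) := by
  intro p hp
  have h1 := σ.contMDiffOn_base i p hp
  have h2 := θ.contMDiff.contMDiffAt.comp_contMDiffWithinAt p h1
  have h3 := ContMDiffWithinAt.clm_bundle_apply (E₂ := Bundle.Trivial M ℝ) (F₂ := ℝ)
    h2 (σ.smooth i p hp)
  have h4 := ((contMDiffWithinAt_totalSpace).1 h3).2
  exact (h4.contDiffWithinAt).differentiableWithinAt (by simp)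

/-- The restriction of `H₁ dt + H₂ ds + H₃ du` to the face `s = c`. -/
def CubeMorphism.restrict [ContMDiffVectorBundle ∞ F A 𝓘(ℝ, E)]
    {L : LieAlgebroid E M F A} (H : CubeMorphism L 3) {c : ℝ}
    (hc : c ∈ Icc (0 : ℝ) 1) : CubeMorphism L 2 where
  base p := H.base (face c p)
  comp i p := H.comp (faceIdx i) (face c p)
  smooth i := (H.smooth (faceIdx i)).comp (contDiff_face c).contMDiff.contMDiffOn (mapsTo_face hc)
  anchor_eq i p hp := by
    rw [H.anchor_eq (faceIdx i) _ (mapsTo_face hc hp), ← faceLin_single]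
    have h1 : HasMFDerivWithinAt 𝓘(ℝ, Fin 2 → ℝ) 𝓘(ℝ, Fin 3 → ℝ) (face c) (cube 2) p faceLin :=
      (hasFDerivAt_face c p).hasFDerivWithinAt.hasMFDerivWithinAt
    have h2 := (((H.contMDiffOn_base 0) _ (mapsTo_face hc hp)).mdifferentiableWithinAt
      (by simp)).hasMFDerivWithinAt
    have h3 := (h2.comp p h1 (mapsTo_face hc)).mfderivWithin
      ((uniqueDiffOn_cube 2).uniqueMDiffOn p hp)
    change _ = mfderivWithin _ _ (H.base ∘ face c) _ _ _
    rw [h3]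
    rfl
  d_eq i j hij p hp θ X Y hX hY := by
    have key : ∀ k : Fin 3, ∀ i : Fin 2,
        fderivWithin ℝ (fun q => θ.pair (H.base (face c q)) (H.comp k (face c q))) (cube 2) p
          (Pi.single i 1)
        = fderivWithin ℝ (fun q => θ.pair (H.base q) (H.comp k q)) (cube 3) (face c p)
          (Pi.single (faceIdx i) 1) := by
      intro k i
      have h1 := (hasFDerivAt_face c p).hasFDerivWithinAt (s := cube 2)
      have h2 := (H.differentiableOn_pair θ k _ (mapsTo_face hc hp)).hasFDerivWithinAt
      have h3 := (h2.comp p h1 (mapsTo_face hc)).fderivWithin (uniqueDiffOn_cube 2 p hp)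
      rw [← faceLin_single]
      exact congrArg (fun T => T (Pi.single i 1)) h3
    rw [key, key]
    refine H.d_eq (faceIdx i) (faceIdx j) ?_ _ (mapsTo_face hc hp) θ X Y hX hY
    fin_cases i <;> fin_cases j <;> simp_all [faceIdx]

lemma ThreeHomotopic.thin_src [ContMDiffVectorBundle ∞ F A 𝓘(ℝ, E)]
    {L : LieAlgebroid E M F A} {x y : M} {σ₀ σ₁ : TotalAHomotopy L x y}
    (h : ThreeHomotopic L σ₀ σ₁) : ThinHomotopic L σ₀.src σ₁.src := by
  obtain ⟨H, ht, hs, h0, h1⟩ := h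
  have z : (0 : ℝ) ∈ Icc (0 : ℝ) 1 := by simp
  refine ⟨⟨H.restrict z, fun t h => ?_, fun t h => ?_, fun s h => ?_, fun s h => ?_⟩, fun p hp => ?_⟩
  · exact (h0 t h 0 z).1.trans (σ₀.hom.source_eq t h)
  · exact (h1 t h 0 z).1.trans (σ₁.hom.source_eq t h)
  · exact (ht 0 z s h).1
  · exact (ht 0 z s h).2
  · have : (H.restrict z).comp 1 p = 0 := (hs (p 0) ⟨hp.1 0, hp.2 0⟩ (p 1) ⟨hp.1 1, hp.2 1⟩).1
    change _ * ExteriorAlgebra.ι ℝ ((H.restrict z).comp 1 p) = 0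
    rw [this, map_zero, mul_zero]

lemma ThreeHomotopic.thin_tgt [ContMDiffVectorBundle ∞ F A 𝓘(ℝ, E)]
    {L : LieAlgebroid E M F A} {x y : M} {σ₀ σ₁ : TotalAHomotopy L x y}
    (h : ThreeHomotopic L σ₀ σ₁) : ThinHomotopic L σ₀.tgt σ₁.tgt := by
  obtain ⟨H, ht, hs, h0, h1⟩ := h
  have z : (1 : ℝ) ∈ Icc (0 : ℝ) 1 := by simp
  refine ⟨⟨H.restrict z, fun t h => ?_, fun t h => ?_, fun s h => ?_, fun s h => ?_⟩, fun p hp => ?_⟩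
  · exact (h0 t h 1 z).1.trans (σ₀.hom.target_eq t h)
  · exact (h1 t h 1 z).1.trans (σ₁.hom.target_eq t h)
  · exact (ht 1 z s h).1
  · exact (ht 1 z s h).2
  · have : (H.restrict z).comp 1 p = 0 := (hs (p 0) ⟨hp.1 0, hp.2 0⟩ (p 1) ⟨hp.1 1, hp.2 1⟩).2
    change _ * ExteriorAlgebra.ι ℝ ((H.restrict z).comp 1 p) = 0
    rw [this, map_zero, mul_zero]

/-- The vertical source `P₂ → P₁`. -/
def P₂.src [ContMDiffVectorBundle ∞ F A 𝓘(ℝ, E)] {L : LieAlgebroid E M F A} {x y : M} :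
    P₂ L x y → P₁ L x y :=
  Quot.lift (fun σ => P₁.mk σ.src) fun _ _ h => Quot.sound h.thin_src

/-- The vertical target `P₂ → P₁`. -/
def P₂.tgt [ContMDiffVectorBundle ∞ F A 𝓘(ℝ, E)] {L : LieAlgebroid E M F A} {x y : M} :
    P₂ L x y → P₁ L x y :=
  Quot.lift (fun σ => P₁.mk σ.tgt) fun _ _ h => Quot.sound h.thin_tgt

/-- Two 1-morphisms are identified in the 1-truncation if there is a 2-morphism between them. -/
def P₂.Related [ContMDiffVectorBundle ∞ F A 𝓘(ℝ, E)] (L : LieAlgebroid E M F A) {x y : M}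
    (α β : P₁ L x y) : Prop :=
  ∃ p : P₂ L x y, p.src = α ∧ p.tgt = β

/-- The arrows `x → y` of the 1-truncation `P₁(A) / P₂(A)` of the Weinstein 2-groupoid. -/
def Truncation [ContMDiffVectorBundle ∞ F A 𝓘(ℝ, E)] (L : LieAlgebroid E M F A) (x y : M) :=
  Quot (P₂.Related L (x := x) (y := y))

/-- The orbit of a 1-morphism. -/
def Truncation.mk [ContMDiffVectorBundle ∞ F A 𝓘(ℝ, E)] {L : LieAlgebroid E M F A} {x y : M}
    (α : P₁ L x y) : Truncation L x y := Quot.mk _ α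

end Algebroid

section Groupoids

/-- A groupoid structure on a family of sets of arrows `Hom x y` from `x` to `y`;
`comp g f` is "`f`, then `g`". -/
structure GroupoidOver {M : Type*} (Hom : M → M → Type*) where
  one : ∀ x, Hom x x
  comp : ∀ {x y z}, Hom y z → Hom x y → Hom x z
  inv : ∀ {x y}, Hom x y → Hom y x
  assoc : ∀ {w x y z} (h : Hom y z) (g : Hom x y) (f : Hom w x),
    comp (comp h g) f = comp h (comp g f)
  one_comp : ∀ {x y} (f : Hom x y), comp (one y) f = f
  comp_one : ∀ {x y} (f : Hom x y), comp f (one x) = f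
  inv_comp : ∀ {x y} (f : Hom x y), comp (inv f) f = one x
  comp_inv : ∀ {x y} (f : Hom x y), comp f (inv f) = one y

/-- Morphisms of groupoids over `M` which are the identity on objects. -/
structure GroupoidOver.IsMorphism {M : Type*} {Hom Hom' : M → M → Type*} (S : GroupoidOver Hom)
    (T : GroupoidOver Hom') (φ : ∀ x y, Hom x y → Hom' x y) : Prop where
  map_one : ∀ x, φ x x (S.one x) = T.one x
  map_comp : ∀ {x y z} (g : Hom y z) (f : Hom x y),
    φ x z (S.comp g f) = T.comp (φ y z g) (φ x y f)
  map_inv : ∀ {x y} (f : Hom x y), φ y x (S.inv f) = T.inv (φ x y f)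

end Groupoids

section Concatenation

/-- Cut-off functions. -/
structure IsCutoff (τ : ℝ → ℝ) : Prop where
  smooth : ContDiff ℝ ∞ τ
  mem_Icc : ∀ t, τ t ∈ Icc (0 : ℝ) 1
  eq_zero : ∀ t ≤ 0, τ t = 0
  eq_one : ∀ t, 1 ≤ t → τ t = 1

variable {E : Type uE} [NormedAddCommGroup E] [NormedSpace ℝ E]
  {M : Type uM} [TopologicalSpace M] [ChartedSpace E M] [IsManifold 𝓘(ℝ, E) ∞ M]
  {F : Type uF} [NormedAddCommGroup F] [NormedSpace ℝ F]
  {A : M → Type uA} [TopologicalSpace (TotalSpace F A)]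
  [∀ x, AddCommGroup (A x)] [∀ x, Module ℝ (A x)] [∀ x, TopologicalSpace (A x)]
  [FiberBundle F A] [VectorBundle ℝ F A] {L : LieAlgebroid E M F A}

/-- Scalar multiplication in the fibres of `A`. -/
def scale (r : ℝ) (v : TotalSpace F A) : TotalSpace F A := ⟨v.1, r • v.2⟩

/-- `e` is the unit path `0_x dt` at `x`. -/
def IsUnitPath {x : M} (e : APath L x x) : Prop :=
  ∀ t ∈ Icc (0 : ℝ) 1, e.at t = ⟨x, 0⟩

/-- `b` is the inverse path `-a(1 - t) dt` of `a`. -/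
def IsInverse {x y : M} (a : APath L x y) (b : APath L y x) : Prop :=
  ∀ t ∈ Icc (0 : ℝ) 1, b.at t = scale (-1) (a.at (1 - t))

/-- `a'` is the reparametrization `τ'(t) a(τ(t)) dt` of `a`. -/
def IsReparam (τ : ℝ → ℝ) {x y : M} (a a' : APath L x y) : Prop :=
  ∀ t ∈ Icc (0 : ℝ) 1, a'.at t = scale (deriv τ t) (a.at (τ t))

/-- `c` is the concatenation "`a`, then `b`". -/
def IsConcat {x y z : M} (a : APath L x y) (b : APath L y z) (c : APath L x z) : Prop :=
  (∀ t ∈ Icc (0 : ℝ) (1 / 2), c.at t = scale 2 (a.at (2 * t))) ∧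
  (∀ t ∈ Icc (1 / 2 : ℝ) 1, c.at t = scale 2 (b.at (2 * t - 1)))

/-- The groupoid structure `S` on classes of `A`-paths is the one given by concatenation: units and
inverses are represented by unit paths and inverse paths, and a product is represented by the
concatenation of the representatives, if this concatenation is smooth, and in general by the
concatenation of their reparametrizations by any cut-off function. -/
structure IsConcatenationStructure {Hom : M → M → Type*} (S : GroupoidOver Hom)
    (cls : ∀ x y, APath L x y → Hom x y) : Prop where
  one_eq : ∀ x, ∃ e : APath L x x, IsUnitPath e ∧ S.one x = cls x x e
  inv_eq : ∀ {x y} (a : APath L x y), ∃ b : APath L y x,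
    IsInverse a b ∧ S.inv (cls x y a) = cls y x b
  comp_eq : ∀ {x y z} (a : APath L x y) (b : APath L y z) (c : APath L x z), IsConcat a b c →
    S.comp (cls y z b) (cls x y a) = cls x z c
  comp_reparam : ∀ (τ : ℝ → ℝ), IsCutoff τ → ∀ {x y z} (a : APath L x y) (b : APath L y z),
    ∃ (a' : APath L x y) (b' : APath L y z) (c : APath L x z),
      IsReparam τ a a' ∧ IsReparam τ b b' ∧ IsConcat a' b' c ∧
      S.comp (cls y z b) (cls x y a) = cls x z c

end Concatenation

end Weinstein

end

noncomputable section

/-! A 2-morphism between the thin classes of two paths exists exactly when the paths are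
`A`-homotopic. One direction takes the class of the homotopy. Conversely, the ends of a representing
homotopy are thin homotopic to the given paths, and thin homotopies are in particular `A`-homotopies
(`related_mk_iff`). So both quotients identify the same paths, and `truncationEquiv` is the
resulting bijection. The substance lies in the groupoid structures; `Homotopic P` constructs the
thin and the ordinary one at once.

Two operations on morphisms `T I^n → A` carry everything. `CubeMorphism.pull` is the pullback along
a smooth map of cubes. It satisfies the structure equation because `d_A θ` depends only on the two
vectors at the point (`LieAlgebroid.d_congr`), so that it is bilinear in them, and because second
derivatives are symmetric. `CubeMorphism.exists_concat` joins two morphisms in one coordinate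
direction. A cut-off function slows both down at the seam, and smoothness there is proved in a chart
by `contMDiffWithinAt_glue`. Joining in the homotopy direction gives transitivity, and joining in
the path direction gives compatibility with products.

The groupoid laws come from one principle, `homotopic_of_pullsOn`: two reparametrizations of the
same path with the same end parameters are joined by linear interpolation of the parameters. This
homotopy factors through an interval, hence is thin. Units, inverses and independence of the cut-off
follow by writing both sides as such reparametrizations. For associativity the iterated product is
reparametrized so that its breaks move to where the other bracketing has them, and the pieces are
then compared separately. -/

namespace Weinstein

set_option linter.unusedSectionVars false

open Filter Topology Function

/-! ### Pointwise nature of the Lie algebroid differential -/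

section Tensoriality

variable {E : Type*} [NormedAddCommGroup E] [NormedSpace ℝ E]
  {M : Type*} [TopologicalSpace M] [ChartedSpace E M]
  {F : Type*} [NormedAddCommGroup F] [NormedSpace ℝ F]
  {A : M → Type*} [TopologicalSpace (TotalSpace F A)]
  [∀ x, AddCommGroup (A x)] [∀ x, Module ℝ (A x)] [∀ x, TopologicalSpace (A x)]
  [FiberBundle F A] [VectorBundle ℝ F A] [IsManifold 𝓘(ℝ, E) ∞ M]

/-- Smooth functions with value `1` at a point and support in a given neighbourhood. -/
lemma exists_bump [FiniteDimensional ℝ E] [T2Space M] {x : M} {U : Set M} (hU : U ∈ 𝓝 x) :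
    ∃ ψ : C^∞⟮𝓘(ℝ, E), M; 𝓘(ℝ, ℝ), ℝ⟯, ψ x = 1 ∧ tsupport ψ ⊆ U := by
  obtain ⟨f, -, hf⟩ := (SmoothBumpFunction.nhds_basis_tsupport (I := 𝓘(ℝ, E)) x).mem_iff.1 hU
  exact ⟨⟨f, f.contMDiff⟩, f.eq_one, hf⟩

/-- Every vector of a smooth vector bundle is a value of a smooth section. -/
lemma exists_section_eq [FiniteDimensional ℝ E] [T2Space M] [ContMDiffVectorBundle ∞ F A 𝓘(ℝ, E)]
    {x : M} (v : A x) : ∃ X : Cₛ^∞⟮𝓘(ℝ, E); F, A⟯, X x = v := by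
  obtain ⟨s, hs, hX⟩ := FiberBundle.exists_contMDiffOn_extend (k := ∞) 𝓘(ℝ, E) F v
  obtain ⟨ψ, hψ, hsupp⟩ := exists_bump (E := E) (interior_mem_nhds.2 hs)
  refine ⟨⟨_, ContMDiffOn.smul_section_of_tsupport ψ.contMDiff.contMDiffOn isOpen_interior hsupp
    (hX.mono interior_subset)⟩, ?_⟩
  simp [hψ]

lemma dirDeriv_add {f g : M → ℝ} {x : M} (hf : MDifferentiableAt 𝓘(ℝ, E) 𝓘(ℝ, ℝ) f x)
    (hg : MDifferentiableAt 𝓘(ℝ, E) 𝓘(ℝ, ℝ) g x) (v : TangentSpace 𝓘(ℝ, E) x) :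
    dirDeriv (fun y => f y + g y) x v = dirDeriv f x v + dirDeriv g x v :=
  congrArg (fun T : E →L[ℝ] ℝ => T v) (mfderiv_add hf hg)

lemma dirDeriv_mul {f g : M → ℝ} {x : M} (hf : MDifferentiableAt 𝓘(ℝ, E) 𝓘(ℝ, ℝ) f x)
    (hg : MDifferentiableAt 𝓘(ℝ, E) 𝓘(ℝ, ℝ) g x) (v : TangentSpace 𝓘(ℝ, E) x) :
    dirDeriv (fun y => f y * g y) x v = f x * dirDeriv g x v + dirDeriv f x v * g x := by
  have h := (hf.hasMFDerivAt.mul hg.hasMFDerivAt).mfderiv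
  have h' := congrArg (fun T : E →L[ℝ] ℝ => T v) h
  refine h'.trans ?_
  rw [mul_comm (dirDeriv f x v)]
  rfl

variable [ContMDiffVectorBundle ∞ F A 𝓘(ℝ, E)]

lemma DualSection.contMDiff_pair (θ : DualSection E M F A) (X : Cₛ^∞⟮𝓘(ℝ, E); F, A⟯) :
    ContMDiff 𝓘(ℝ, E) 𝓘(ℝ, ℝ) ∞ (fun y => θ.pair y (X y)) := by
  intro p
  have h3 := ContMDiffAt.clm_bundle_apply (E₂ := Bundle.Trivial M ℝ) (F₂ := ℝ)
    (θ.contMDiff p) (X.contMDiff p)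
  exact ((contMDiffAt_totalSpace).1 h3).2

lemma DualSection.mdifferentiableAt_pair (θ : DualSection E M F A) (X : Cₛ^∞⟮𝓘(ℝ, E); F, A⟯)
    (x : M) : MDifferentiableAt 𝓘(ℝ, E) 𝓘(ℝ, ℝ) (fun y => θ.pair y (X y)) x :=
  (θ.contMDiff_pair X).mdifferentiable (by simp) x

lemma DualSection.pair_add (θ : DualSection E M F A) (x : M) (v w : A x) :
    θ.pair x (v + w) = θ.pair x v + θ.pair x w := map_add (θ x) v w

lemma DualSection.pair_smul (θ : DualSection E M F A) (x : M) (c : ℝ) (v : A x) :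
    θ.pair x (c • v) = c * θ.pair x v := map_smul (θ x) c v

lemma LieAlgebroid.bracket_swap (L : LieAlgebroid E M F A) (X Y : Cₛ^∞⟮𝓘(ℝ, E); F, A⟯) :
    L.bracket Y X = - L.bracket X Y := by
  have h := L.bracket_self (X + Y)
  simp only [map_add, LinearMap.add_apply, L.bracket_self, zero_add, add_zero] at h
  exact eq_neg_of_add_eq_zero_left h

lemma LieAlgebroid.d_swap (L : LieAlgebroid E M F A) (θ : DualSection E M F A)
    (X Y : Cₛ^∞⟮𝓘(ℝ, E); F, A⟯) (x : M) : L.d θ Y X x = - L.d θ X Y x := by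
  have h : θ.pair x (L.bracket Y X x) = - θ.pair x (L.bracket X Y x) := by
    rw [L.bracket_swap X Y]
    exact map_neg (θ x) (L.bracket X Y x)
  simp only [LieAlgebroid.d, h]
  ring

lemma LieAlgebroid.d_add_right (L : LieAlgebroid E M F A) (θ : DualSection E M F A)
    (X Y Z : Cₛ^∞⟮𝓘(ℝ, E); F, A⟯) (x : M) : L.d θ X (Y + Z) x = L.d θ X Y x + L.d θ X Z x := by
  have h1 : dirDeriv (fun y => θ.pair y ((Y + Z) y)) x (L.anchor x (X x))
      = dirDeriv (fun y => θ.pair y (Y y)) x (L.anchor x (X x))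
        + dirDeriv (fun y => θ.pair y (Z y)) x (L.anchor x (X x)) := by
    rw [← dirDeriv_add (θ.mdifferentiableAt_pair Y x) (θ.mdifferentiableAt_pair Z x)]
    congr 1
    funext y
    exact θ.pair_add y _ _
  have h2 : dirDeriv (fun y => θ.pair y (X y)) x (L.anchor x ((Y + Z) x))
      = dirDeriv (fun y => θ.pair y (X y)) x (L.anchor x (Y x))
        + dirDeriv (fun y => θ.pair y (X y)) x (L.anchor x (Z x)) := by
    simp only [dirDeriv, ContMDiffSection.coe_add, Pi.add_apply, map_add]
    rfl
  have h3 : θ.pair x (L.bracket X (Y + Z) x)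
      = θ.pair x (L.bracket X Y x) + θ.pair x (L.bracket X Z x) := by
    rw [map_add]
    exact θ.pair_add x _ _
  simp only [LieAlgebroid.d, h1, h2, h3]
  ring

/-- The derivative of `f` appears twice, in the product rule for `θ(f Y)` and in the Leibniz rule
for the bracket, and the two terms cancel. -/
lemma LieAlgebroid.d_funSmul_right (L : LieAlgebroid E M F A) (θ : DualSection E M F A)
    (X Y : Cₛ^∞⟮𝓘(ℝ, E); F, A⟯) (f : C^∞⟮𝓘(ℝ, E), M; 𝓘(ℝ, ℝ), ℝ⟯) (x : M) :
    L.d θ X (funSmul f Y) x = f x * L.d θ X Y x := by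
  have h1 : dirDeriv (fun y => θ.pair y (funSmul f Y y)) x (L.anchor x (X x))
      = f x * dirDeriv (fun y => θ.pair y (Y y)) x (L.anchor x (X x))
        + dirDeriv f x (L.anchor x (X x)) * θ.pair x (Y x) := by
    rw [← dirDeriv_mul (f.contMDiff.mdifferentiable (by simp) x) (θ.mdifferentiableAt_pair Y x)]
    congr 1
    funext y
    exact θ.pair_smul y _ _
  have h2 : dirDeriv (fun y => θ.pair y (X y)) x (L.anchor x (funSmul f Y x))
      = f x * dirDeriv (fun y => θ.pair y (X y)) x (L.anchor x (Y x)) := by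
    change dirDeriv _ x (L.anchor x (f x • Y x)) = _
    simp only [dirDeriv, map_smul]
    rfl
  have h3 : θ.pair x (L.bracket X (funSmul f Y) x)
      = f x * θ.pair x (L.bracket X Y x) + dirDeriv f x (L.anchor x (X x)) * θ.pair x (Y x) := by
    rw [L.leibniz, θ.pair_add, θ.pair_smul, θ.pair_smul]
  simp only [LieAlgebroid.d, h1, h2, h3]
  ring

/-- The differential of a 1-form, as a linear map in its second argument. -/
def LieAlgebroid.dRight (L : LieAlgebroid E M F A) (θ : DualSection E M F A)
    (X : Cₛ^∞⟮𝓘(ℝ, E); F, A⟯) (x : M) : Cₛ^∞⟮𝓘(ℝ, E); F, A⟯ →ₗ[ℝ] ℝ where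
  toFun Y := L.d θ X Y x
  map_add' Y Z := L.d_add_right θ X Y Z x
  map_smul' c Y := L.d_funSmul_right θ X Y ⟨fun _ => c, contMDiff_const⟩ x

/-- Linearity over smooth functions gives pointwise dependence: near `x` the section is a
combination of a local frame whose coefficients vanish at `x`. -/
lemma LieAlgebroid.d_eq_zero_right [FiniteDimensional ℝ E] [FiniteDimensional ℝ F] [T2Space M]
    (L : LieAlgebroid E M F A) (θ : DualSection E M F A)
    (X Y : Cₛ^∞⟮𝓘(ℝ, E); F, A⟯) {x : M} (hY : Y x = 0) : L.d θ X Y x = 0 := by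
  have : ContMDiffVectorBundle 1 F A 𝓘(ℝ, E) := .of_le (n := ∞) (by simp)
  let t := trivializationAt F A x
  have hx : x ∈ t.baseSet := FiberBundle.mem_baseSet_trivializationAt F A x
  let b := Module.Basis.ofVectorSpace ℝ F
  obtain ⟨ψ, hψ, hsupp⟩ := exists_bump (E := E) (t.open_baseSet.mem_nhds hx)
  let Z i : Cₛ^∞⟮𝓘(ℝ, E); F, A⟯ := ⟨_, ContMDiffOn.smul_section_of_tsupport
    ψ.contMDiff.contMDiffOn t.open_baseSet hsupp (t.contMDiffOn_localFrame_baseSet ∞ b i)⟩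
  let g i : C^∞⟮𝓘(ℝ, E), M; 𝓘(ℝ, ℝ), ℝ⟯ :=
    ⟨fun y => ψ y • (LinearMap.piApply (t.localFrameCoeff 𝓘(ℝ, E) b i)) Y y, by
      refine contMDiff_of_tsupport fun y hy => ?_
      have hy' : y ∈ t.baseSet := hsupp (tsupport_smul_subset_left _ _ hy)
      exact ψ.contMDiff.contMDiffAt.smul (contMDiffAt_localFrameCoeff b hy' (Y.contMDiff y) i)⟩
  -- One factor `ψ` extends the coefficients to global functions, the other extends the frame. Both
  -- equal `1` at `x`, so the value of the differential there is unchanged.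
  have key : funSmul ψ (funSmul ψ Y) = ∑ i, funSmul (g i) (Z i) := by
    ext y
    have hs : (∑ i, funSmul (g i) (Z i)) y = ∑ i, funSmul (g i) (Z i) y := by
      have := congrFun (map_sum (ContMDiffSection.coeAddHom 𝓘(ℝ, E) F ∞ A)
        (fun i => funSmul (g i) (Z i)) Finset.univ) y
      exact this.trans (Finset.sum_apply _ _ _)
    rw [hs]
    by_cases hy : y ∈ t.baseSet
    · change ψ y • ψ y • Y y = ∑ i, (ψ y • t.localFrameCoeff 𝓘(ℝ, E) b i y (Y y)) •
        (ψ y • t.localFrame b i y)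
      conv_lhs => rw [t.eq_sum_localFrameCoeff_smul (I := 𝓘(ℝ, E)) (b := b) (s := Y) hy]
      rw [Finset.smul_sum, Finset.smul_sum]
      refine Finset.sum_congr rfl fun i _ => ?_
      simp only [smul_smul, smul_eq_mul]
      ring_nf
    · have h0 : ψ y = 0 := image_eq_zero_of_notMem_tsupport fun h => hy (hsupp h)
      change ψ y • ψ y • Y y = ∑ i, (ψ y • t.localFrameCoeff 𝓘(ℝ, E) b i y (Y y)) •
        (ψ y • t.localFrame b i y)
      simp [h0]
  have h1 : L.dRight θ X x (funSmul ψ (funSmul ψ Y)) = L.d θ X Y x := by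
    change L.d _ _ _ _ = _
    rw [L.d_funSmul_right, L.d_funSmul_right, hψ, one_mul, one_mul]
  rw [← h1, key, map_sum]
  refine Finset.sum_eq_zero fun i _ => ?_
  change L.d _ _ _ _ = _
  rw [L.d_funSmul_right]
  have : g i x = 0 := by
    change ψ x • t.localFrameCoeff 𝓘(ℝ, E) b i x (Y x) = 0
    rw [hY, map_zero, smul_zero]
  rw [this, zero_mul]

variable [FiniteDimensional ℝ E] [FiniteDimensional ℝ F] [T2Space M]

lemma LieAlgebroid.d_congr_right (L : LieAlgebroid E M F A) (θ : DualSection E M F A)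
    (X : Cₛ^∞⟮𝓘(ℝ, E); F, A⟯) {Y Y' : Cₛ^∞⟮𝓘(ℝ, E); F, A⟯} {x : M} (h : Y x = Y' x) :
    L.d θ X Y x = L.d θ X Y' x := by
  have h0 : L.dRight θ X x (Y - Y') = 0 := by
    refine L.d_eq_zero_right θ X (Y - Y') ?_
    rw [ContMDiffSection.coe_sub, Pi.sub_apply, h, sub_self]
  rw [map_sub, sub_eq_zero] at h0
  exact h0

/-- This permits replacing the arbitrary sections in `d_eq` of a `CubeMorphism` by combinations of
chosen ones. -/
lemma LieAlgebroid.d_congr (L : LieAlgebroid E M F A) (θ : DualSection E M F A)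
    {X X' Y Y' : Cₛ^∞⟮𝓘(ℝ, E); F, A⟯} {x : M} (hX : X x = X' x) (hY : Y x = Y' x) :
    L.d θ X Y x = L.d θ X' Y' x := by
  rw [L.d_congr_right θ X hY, L.d_swap θ Y' X, L.d_congr_right θ Y' hX, ← L.d_swap]

lemma LieAlgebroid.d_sum_smul (L : LieAlgebroid E M F A) (θ : DualSection E M F A) {ι : Type*}
    [Fintype ι] (c c' : ι → ℝ) (X : ι → Cₛ^∞⟮𝓘(ℝ, E); F, A⟯) (x : M) :
    L.d θ (∑ i, c i • X i) (∑ i, c' i • X i) x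
      = ∑ i, ∑ j, c i * c' j * L.d θ (X i) (X j) x := by
  have h (Z : Cₛ^∞⟮𝓘(ℝ, E); F, A⟯) (c : ι → ℝ) :
      L.d θ Z (∑ i, c i • X i) x = ∑ i, c i * L.d θ Z (X i) x := by
    have := map_sum (L.dRight θ Z x) (fun i => c i • X i) Finset.univ
    simp only [map_smul, smul_eq_mul] at this
    exact this
  rw [h, Finset.sum_comm]
  refine Finset.sum_congr rfl fun j _ => ?_
  rw [L.d_swap, h, ← Finset.sum_neg_distrib, Finset.mul_sum]
  refine Finset.sum_congr rfl fun i _ => ?_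
  rw [L.d_swap θ (X i) (X j)]
  ring

end Tensoriality

/-! ### Pullback of morphisms along smooth maps of cubes -/

section Pullback

variable {E : Type*} [NormedAddCommGroup E] [NormedSpace ℝ E]
  {M : Type*} [TopologicalSpace M] [ChartedSpace E M]
  {F : Type*} [NormedAddCommGroup F] [NormedSpace ℝ F]
  {A : M → Type*} [TopologicalSpace (TotalSpace F A)]
  [∀ x, AddCommGroup (A x)] [∀ x, Module ℝ (A x)] [∀ x, TopologicalSpace (A x)]
  [FiberBundle F A] [VectorBundle ℝ F A]

/-- Linear combinations, with smooth coefficients, of smooth sections along a map are smooth. -/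
lemma contMDiffWithinAt_sum_smul {V : Type*} [NormedAddCommGroup V] [NormedSpace ℝ V]
    {ι : Type*} [Fintype ι] {b : V → M} {v : ι → ∀ p, A (b p)} {c : ι → V → ℝ} {s : Set V} {p₀ : V}
    (hb : ContMDiffWithinAt 𝓘(ℝ, V) 𝓘(ℝ, E) ∞ b s p₀)
    (hv : ∀ i, ContMDiffWithinAt 𝓘(ℝ, V) (𝓘(ℝ, E).prod 𝓘(ℝ, F)) ∞
      (fun p => (⟨b p, v i p⟩ : TotalSpace F A)) s p₀)
    (hc : ∀ i, ContDiffWithinAt ℝ ∞ (c i) s p₀) :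
    ContMDiffWithinAt 𝓘(ℝ, V) (𝓘(ℝ, E).prod 𝓘(ℝ, F)) ∞
      (fun p => (⟨b p, ∑ i, c i p • v i p⟩ : TotalSpace F A)) s p₀ := by
  rw [contMDiffWithinAt_totalSpace]
  refine ⟨hb, ?_⟩
  let t := trivializationAt F A (b p₀)
  have hx : b p₀ ∈ t.baseSet := FiberBundle.mem_baseSet_trivializationAt F A _
  have hlin : ∀ p, b p ∈ t.baseSet → (t ⟨b p, ∑ i, c i p • v i p⟩).2
      = ∑ i, c i p • (t ⟨b p, v i p⟩).2 := by
    intro p hp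
    have h (w : A (b p)) : (t ⟨b p, w⟩).2 = t.linearMapAt ℝ (b p) w := by
      rw [t.linearMapAt_apply, if_pos hp]
    simp only [h, map_sum, map_smul]
  have hmain : ContMDiffWithinAt 𝓘(ℝ, V) 𝓘(ℝ, F) ∞
      (fun p => ∑ i, c i p • (t ⟨b p, v i p⟩).2) s p₀ := by
    rw [contMDiffWithinAt_iff_contDiffWithinAt]
    refine ContDiffWithinAt.sum fun i _ => (hc i).smul ?_
    exact ((contMDiffWithinAt_totalSpace).1 (hv i)).2.contDiffWithinAt
  refine hmain.congr_of_eventuallyEq ?_ (hlin _ hx)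
  exact (hb.continuousWithinAt.eventually (t.open_baseSet.mem_nhds hx)).mono fun p hp => hlin p hp

variable [IsManifold 𝓘(ℝ, E) ∞ M] [ContMDiffVectorBundle ∞ F A 𝓘(ℝ, E)]
  {L : LieAlgebroid E M F A}

lemma DualSection.pair_sum_smul (θ : DualSection E M F A) (x : M) {ι : Type*} [Fintype ι]
    (c : ι → ℝ) (v : ι → A x) : θ.pair x (∑ i, c i • v i) = ∑ i, c i * θ.pair x (v i) := by
  have h := map_sum (θ x) (fun i => c i • v i) Finset.univ
  refine h.trans (Finset.sum_congr rfl fun i _ => ?_)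
  exact θ.pair_smul x _ _

/-- The Jacobian of a map between Euclidean spaces: `jac φ p j k` is `∂_j φ_k` at `p`. -/
def jac {m n : ℕ} (φ : (Fin m → ℝ) → (Fin n → ℝ)) (p : Fin m → ℝ) (j : Fin m) (k : Fin n) : ℝ :=
  fderiv ℝ φ p (Pi.single j 1) k

lemma fderiv_single_eq_sum {m n : ℕ} (φ : (Fin m → ℝ) → (Fin n → ℝ)) (p : Fin m → ℝ)
    (j : Fin m) : fderiv ℝ φ p (Pi.single j 1) = ∑ k, jac φ p j k • Pi.single k (1 : ℝ) := by
  funext k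
  simp [jac, Finset.sum_apply, Pi.single_apply]

lemma contDiff_jac {m n : ℕ} {φ : (Fin m → ℝ) → (Fin n → ℝ)} (hφ : ContDiff ℝ ∞ φ)
    (j : Fin m) (k : Fin n) : ContDiff ℝ ∞ (fun p => jac φ p j k) := by
  have h1 : ContDiff ℝ ∞ (fderiv ℝ φ) := hφ.fderiv_right (by simp)
  exact contDiff_pi.1 (h1.clm_apply contDiff_const) k

/-- Symmetry of second derivatives. It cancels the terms of the structure equation of a pullback in
which the Jacobian is differentiated. -/
lemma fderiv_jac_symm {m n : ℕ} {φ : (Fin m → ℝ) → (Fin n → ℝ)} (hφ : ContDiff ℝ ∞ φ)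
    (p : Fin m → ℝ) (i j : Fin m) (k : Fin n) :
    fderiv ℝ (fun p => jac φ p j k) p (Pi.single i 1)
      = fderiv ℝ (fun p => jac φ p i k) p (Pi.single j 1) := by
  have h1 : DifferentiableAt ℝ (fderiv ℝ φ) p :=
    (hφ.fderiv_right (m := ∞) (by simp)).differentiable (by simp) p
  have h2 : ∀ i j : Fin m, fderiv ℝ (fun p => jac φ p j k) p (Pi.single i 1)
      = fderiv ℝ (fderiv ℝ φ) p (Pi.single i 1) (Pi.single j 1) k := by
    intro i j
    have h3 : HasFDerivAt (fun p => fderiv ℝ φ p (Pi.single j 1)) _ p :=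
      h1.hasFDerivAt.clm_apply (hasFDerivAt_const (Pi.single j 1 : Fin m → ℝ) p)
    have h4 := (hasFDerivAt_pi'.1 h3 k).fderiv
    change fderiv ℝ (fun p => fderiv ℝ φ p (Pi.single j 1) k) p _ = _
    rw [h4]
    simp
  rw [h2, h2]
  have hs := (hφ.contDiffAt (x := p)).isSymmSndFDerivAt (by
    rw [minSmoothness_of_isRCLikeNormedField]
    exact WithTop.coe_le_coe.2 le_top)
  rw [hs.eq]

variable [FiniteDimensional ℝ E] [FiniteDimensional ℝ F] [T2Space M]

/-- Both sides are antisymmetric in the two indices, so the case `i < j` gives all pairs, the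
diagonal included. The double sum in a pullback runs over all of them. -/
lemma CubeMorphism.d_eq_of_ne {n : ℕ} (σ : CubeMorphism L n) (i j : Fin n) {p : Fin n → ℝ}
    (hp : p ∈ cube n) (θ : DualSection E M F A) (X Y : Cₛ^∞⟮𝓘(ℝ, E); F, A⟯)
    (hX : X (σ.base p) = σ.comp i p) (hY : Y (σ.base p) = σ.comp j p) :
    fderivWithin ℝ (fun q => θ.pair (σ.base q) (σ.comp j q)) (cube n) p (Pi.single i 1)
      - fderivWithin ℝ (fun q => θ.pair (σ.base q) (σ.comp i q)) (cube n) p (Pi.single j 1)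
      = L.d θ X Y (σ.base p) := by
  rcases lt_trichotomy i j with h | h | h
  · exact σ.d_eq i j h p hp θ X Y hX hY
  · subst h
    have h1 := L.d_congr θ (hX.trans hY.symm) (rfl : Y (σ.base p) = _)
    have h2 := L.d_swap θ Y Y (σ.base p)
    rw [h1]
    linarith
  · have h1 := σ.d_eq j i h p hp θ Y X hY hX
    rw [L.d_swap, ← h1]
    ring

/-- The pullback of a morphism `T I^n → A` along a smooth map `I^m → I^n`. -/
def CubeMorphism.pull {m n : ℕ} [NeZero n] (σ : CubeMorphism L n) (φ : (Fin m → ℝ) → (Fin n → ℝ))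
    (hφ : ContDiff ℝ ∞ φ) (hm : MapsTo φ (cube m) (cube n)) : CubeMorphism L m where
  base p := σ.base (φ p)
  comp j p := ∑ k, jac φ p j k • σ.comp k (φ p)
  smooth j p hp := by
    have hφ' : ContMDiffWithinAt 𝓘(ℝ, Fin m → ℝ) 𝓘(ℝ, Fin n → ℝ) ∞ φ (cube m) p :=
      hφ.contMDiff.contMDiffAt.contMDiffWithinAt
    refine contMDiffWithinAt_sum_smul ((σ.contMDiffOn_base 0 _ (hm hp)).comp p hφ' hm)
      (fun k => (σ.smooth k _ (hm hp)).comp p hφ' hm)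
      fun k => (contDiff_jac hφ j k).contDiffAt.contDiffWithinAt
  anchor_eq j p hp := by
    have h1 : HasMFDerivWithinAt 𝓘(ℝ, Fin m → ℝ) 𝓘(ℝ, Fin n → ℝ) φ (cube m) p (fderiv ℝ φ p) :=
      ((hφ.differentiable (by simp) p).hasFDerivAt.hasFDerivWithinAt).hasMFDerivWithinAt
    have h2 := ((σ.contMDiffOn_base 0 _ (hm hp)).mdifferentiableWithinAt
      (by simp)).hasMFDerivWithinAt
    have h3 := (h2.comp p h1 hm).mfderivWithin ((uniqueDiffOn_cube m).uniqueMDiffOn p hp)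
    change _ = mfderivWithin _ _ (σ.base ∘ φ) _ _ _
    rw [h3]
    change _ = mfderivWithin 𝓘(ℝ, Fin n → ℝ) 𝓘(ℝ, E) σ.base (cube n) (φ p)
      (fderiv ℝ φ p (Pi.single j (1 : ℝ)))
    rw [fderiv_single_eq_sum, map_sum]
    refine (map_sum (mfderivWithin 𝓘(ℝ, Fin n → ℝ) 𝓘(ℝ, E) σ.base (cube n) (φ p)) _ _).symm ▸ ?_
    refine Finset.sum_congr rfl fun k _ => ?_
    rw [map_smul, σ.anchor_eq k _ (hm hp)]
    exact (map_smul (mfderivWithin 𝓘(ℝ, Fin n → ℝ) 𝓘(ℝ, E) σ.base (cube n) (φ p)) _ _).symm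
  d_eq i j _ p hp θ X Y hX hY := by
    let u (k : Fin n) (q : Fin n → ℝ) : ℝ := θ.pair (σ.base q) (σ.comp k q)
    let w (l k : Fin n) : ℝ := fderivWithin ℝ (u k) (cube n) (φ p) (Pi.single l 1)
    have hu (k : Fin n) (i : Fin m) : HasFDerivWithinAt (fun q => u k (φ q))
        ((fderivWithin ℝ (u k) (cube n) (φ p)).comp (fderiv ℝ φ p)) (cube m) p :=
      (σ.differentiableOn_pair θ k _ (hm hp)).hasFDerivWithinAt.comp p
        (hφ.differentiable (by simp) p).hasFDerivAt.hasFDerivWithinAt hm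
    -- Product and chain rule: a part quadratic in the Jacobian, and a part with second derivatives
    -- of `φ` which is symmetric in `i` and `j`.
    have hder (i j : Fin m) : fderivWithin ℝ
        (fun q => θ.pair (σ.base (φ q)) (∑ k, jac φ q j k • σ.comp k (φ q))) (cube m) p
          (Pi.single i 1)
        = ∑ k, ((∑ l, jac φ p j k * jac φ p i l * w l k)
          + u k (φ p) * fderiv ℝ (fun q => jac φ q j k) p (Pi.single i 1)) := by
      have h1 (k : Fin n) : HasFDerivWithinAt (fun q => jac φ q j k * u k (φ q)) _ (cube m) p :=
        (((contDiff_jac hφ j k).differentiable (by simp) p).hasFDerivAt.hasFDerivWithinAt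
          (s := cube m)).mul (hu k i)
      have h2 := HasFDerivWithinAt.fun_sum (u := Finset.univ) fun k _ => h1 k
      have h3 : (fun q => θ.pair (σ.base (φ q)) (∑ k, jac φ q j k • σ.comp k (φ q)))
          = fun q => ∑ k, jac φ q j k * u k (φ q) := by
        funext q
        exact θ.pair_sum_smul _ _ _
      rw [h3, h2.fderivWithin (uniqueDiffOn_cube m p hp)]
      simp only [_root_.sum_apply, _root_.add_apply,
        _root_.smul_apply, ContinuousLinearMap.comp_apply, smul_eq_mul]
      refine Finset.sum_congr rfl fun k _ => ?_
      rw [fderiv_single_eq_sum φ p i, map_sum, Finset.mul_sum]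
      congr 1
      refine Finset.sum_congr rfl fun l _ => ?_
      rw [map_smul, smul_eq_mul, mul_assoc]
    -- Sections through the components at the single point `φ p` suffice, since the differential is
    -- evaluated only there.
    choose Z hZ using fun k : Fin n => exists_section_eq (E := E) (F := F) (σ.comp k (φ p))
    have hw (l k : Fin n) : w l k - w k l = L.d θ (Z l) (Z k) (σ.base (φ p)) :=
      σ.d_eq_of_ne l k (hm hp) θ (Z l) (Z k) (hZ l) (hZ k)
    have hsum (i : Fin m) : (∑ k, jac φ p i k • Z k) (σ.base (φ p))
        = ∑ k, jac φ p i k • σ.comp k (φ p) := by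
      have := congrFun (map_sum (ContMDiffSection.coeAddHom 𝓘(ℝ, E) F ∞ A)
        (fun k => jac φ p i k • Z k) Finset.univ) (σ.base (φ p))
      refine (this.trans (Finset.sum_apply _ _ _)).trans (Finset.sum_congr rfl fun k _ => ?_)
      change jac φ p i k • Z k (σ.base (φ p)) = _
      rw [hZ]
    rw [L.d_congr θ (hX.trans (hsum i).symm) (hY.trans (hsum j).symm), L.d_sum_smul, hder, hder]
    simp only [← hw, Finset.sum_add_distrib, fderiv_jac_symm hφ p j i, mul_sub,
      Finset.sum_sub_distrib]
    rw [add_sub_add_right_eq_sub, Finset.sum_comm]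
    congr 1
    · refine Finset.sum_congr rfl fun l _ => Finset.sum_congr rfl fun k _ => ?_
      ring

lemma CubeMorphism.pull_val {m n : ℕ} [NeZero n] (σ : CubeMorphism L n)
    (φ : (Fin m → ℝ) → (Fin n → ℝ)) (hφ : ContDiff ℝ ∞ φ) (hm : MapsTo φ (cube m) (cube n))
    (j : Fin m) (p : Fin m → ℝ) :
    (σ.pull φ hφ hm).val j p = ⟨σ.base (φ p), ∑ k, jac φ p j k • σ.comp k (φ p)⟩ := rfl

end Pullback

/-! ### Gluing of morphisms along a hyperplane -/

section Gluing

/-- Let `f`, `g` and `h` be smooth at `p`, with the same value there. If at every point one of `f` and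
`g` agrees with `h` and `k` agrees with the other one, then `k` is smooth at `p`. -/
lemma contMDiffWithinAt_glue {V : Type*} [NormedAddCommGroup V] [NormedSpace ℝ V]
    {E' : Type*} [NormedAddCommGroup E'] [NormedSpace ℝ E'] {H : Type*} [TopologicalSpace H]
    {I : ModelWithCorners ℝ E' H} [I.Boundaryless] {N : Type*} [TopologicalSpace N]
    [ChartedSpace H N] [IsManifold I ∞ N] {f g h k : V → N} {s : Set V} {p : V} (hp : p ∈ s)
    (hf : ContMDiffWithinAt 𝓘(ℝ, V) I ∞ f s p) (hg : ContMDiffWithinAt 𝓘(ℝ, V) I ∞ g s p)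
    (hh : ContMDiffWithinAt 𝓘(ℝ, V) I ∞ h s p) (hfp : f p = h p) (hgp : g p = h p)
    (hk : ∀ q ∈ s, (k q = f q ∧ g q = h q) ∨ (k q = g q ∧ f q = h q)) :
    ContMDiffWithinAt 𝓘(ℝ, V) I ∞ k s p := by
  let e := extChartAt I (h p)
  have hchart (f : V → N) (hf : ContMDiffWithinAt 𝓘(ℝ, V) I ∞ f s p) (hfp : f p = h p) :
      ContDiffWithinAt ℝ ∞ (fun q => e (f q)) s p := by
    rw [← contMDiffWithinAt_iff_contDiffWithinAt]
    refine ContMDiffAt.comp_contMDiffWithinAt p ?_ hf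
    rw [hfp]
    exact contMDiffAt_extChartAt
  -- In a chart `k = f + g - h`: at each point one of `f`, `g` cancels against `h` and the other one
  -- is `k`. This expresses the piecewise map by a single smooth formula.
  have hsum : ContMDiffWithinAt 𝓘(ℝ, V) 𝓘(ℝ, E') ∞
      (fun q => e (f q) + e (g q) - e (h q)) s p :=
    (((hchart f hf hfp).add (hchart g hg hgp)).sub (hchart h hh rfl)).contMDiffWithinAt
  have hval : e (f p) + e (g p) - e (h p) = e (h p) := by
    rw [hfp, hgp, add_sub_cancel_right]
  have hsymm : ContMDiffAt 𝓘(ℝ, E') I ∞ e.symm (e (f p) + e (g p) - e (h p)) := by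
    rw [hval]
    exact (contMDiffOn_extChartAt_symm (h p)).contMDiffAt (extChartAt_target_mem_nhds (h p))
  have hmain := hsymm.comp_contMDiffWithinAt p hsum
  have hmem : e.source ∈ 𝓝 (h p) := extChartAt_source_mem_nhds (h p)
  have hev : ∀ᶠ q in 𝓝[s] p, f q ∈ e.source ∧ g q ∈ e.source := by
    refine (hf.continuousWithinAt.eventually ?_).and (hg.continuousWithinAt.eventually ?_)
    · rw [hfp]; exact hmem
    · rw [hgp]; exact hmem
  have heq : ∀ q ∈ s, f q ∈ e.source ∧ g q ∈ e.source →
      k q = e.symm (e (f q) + e (g q) - e (h q)) := by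
    rintro q hq ⟨h1, h2⟩
    rcases hk q hq with ⟨h3, h4⟩ | ⟨h3, h4⟩
    · rw [h3, h4, add_sub_cancel_right, e.left_inv h1]
    · rw [h3, h4, add_sub_cancel_left, e.left_inv h2]
  refine hmain.congr_of_eventuallyEq ?_ (heq p hp (hev.self_of_nhdsWithin hp))
  filter_upwards [hev, self_mem_nhdsWithin] with q h1 h2 using heq q h2 h1

/-- At a seam the glued map agrees with one of its pieces only on a half cube. That determines the
derivative, because a half cube still has unique derivatives. -/
lemma fderivWithin_eq_of_eqOn_subset {V W : Type*} [NormedAddCommGroup V] [NormedSpace ℝ V]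
    [NormedAddCommGroup W] [NormedSpace ℝ W] {f g : V → W} {s t : Set V} {p : V} (hts : t ⊆ s)
    (hp : p ∈ t) (ht : UniqueDiffWithinAt ℝ t p) (hf : DifferentiableWithinAt ℝ f s p)
    (hg : DifferentiableWithinAt ℝ g s p) (h : EqOn f g t) :
    fderivWithin ℝ f s p = fderivWithin ℝ g s p :=
  ht.eq ((hf.hasFDerivWithinAt.mono hts)) ((hg.hasFDerivWithinAt.mono hts).congr h (h hp))

variable {E : Type*} [NormedAddCommGroup E] [NormedSpace ℝ E]
  {M : Type*} [TopologicalSpace M] [ChartedSpace E M]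

lemma mfderivWithin_eq_of_eqOn_subset {V : Type*} [NormedAddCommGroup V] [NormedSpace ℝ V]
    {f g : V → M} {s t : Set V} {p : V} (hts : t ⊆ s)
    (hp : p ∈ t) (ht : UniqueDiffWithinAt ℝ t p)
    (hf : MDifferentiableWithinAt 𝓘(ℝ, V) 𝓘(ℝ, E) f s p)
    (hg : MDifferentiableWithinAt 𝓘(ℝ, V) 𝓘(ℝ, E) g s p) (h : EqOn f g t) :
    (mfderivWithin 𝓘(ℝ, V) 𝓘(ℝ, E) f s p : V →L[ℝ] E)
      = (mfderivWithin 𝓘(ℝ, V) 𝓘(ℝ, E) g s p : V →L[ℝ] E) :=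
  ht.uniqueMDiffWithinAt.eq ((hf.hasMFDerivWithinAt.mono hts))
    ((hg.hasMFDerivWithinAt.mono hts).congr_of_eventuallyEq
      (h.eventuallyEq_of_mem self_mem_nhdsWithin) (h hp))

lemma uniqueDiffOn_cube_inter_le {n : ℕ} (i : Fin n) :
    UniqueDiffOn ℝ (cube n ∩ {q | q i ≤ 1 / 2}) := by
  refine uniqueDiffOn_convex ((convex_Icc _ _).inter
    (convex_halfSpace_le (LinearMap.proj (R := ℝ) (φ := fun _ => ℝ) i).isLinear _))
    ⟨fun _ => 1 / 4, ?_⟩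
  have : (Set.univ.pi fun _ : Fin n => Ioo (0 : ℝ) (1 / 2)) ⊆ cube n ∩ {q | q i ≤ 1 / 2} :=
    fun p hp => ⟨⟨fun i => (hp i trivial).1.le,
      fun i => (hp i trivial).2.le.trans (by norm_num)⟩, (hp i trivial).2.le⟩
  refine interior_maximal this (isOpen_set_pi finite_univ fun _ _ => isOpen_Ioo) ?_
  intro i _
  norm_num

lemma uniqueDiffOn_cube_inter_ge {n : ℕ} (i : Fin n) :
    UniqueDiffOn ℝ (cube n ∩ {q | 1 / 2 ≤ q i}) := by
  refine uniqueDiffOn_convex ((convex_Icc _ _).inter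
    (convex_halfSpace_ge (LinearMap.proj (R := ℝ) (φ := fun _ => ℝ) i).isLinear _))
    ⟨fun _ => 3 / 4, ?_⟩
  have : (Set.univ.pi fun _ : Fin n => Ioo (1 / 2 : ℝ) 1) ⊆ cube n ∩ {q | 1 / 2 ≤ q i} :=
    fun p hp => ⟨⟨fun i => le_trans (by norm_num) (hp i trivial).1.le,
      fun i => (hp i trivial).2.le⟩, (hp i trivial).1.le⟩
  refine interior_maximal this (isOpen_set_pi finite_univ fun _ _ => isOpen_Ioo) ?_
  intro i _
  norm_num

variable {F : Type*} [NormedAddCommGroup F] [NormedSpace ℝ F]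
  {A : M → Type*} [TopologicalSpace (TotalSpace F A)]
  [∀ x, AddCommGroup (A x)] [∀ x, Module ℝ (A x)] [∀ x, TopologicalSpace (A x)]
  [FiberBundle F A] [VectorBundle ℝ F A]
  [IsManifold 𝓘(ℝ, E) ∞ M] [ContMDiffVectorBundle ∞ F A 𝓘(ℝ, E)]
  {L : LieAlgebroid E M F A}

lemma DualSection.differentiableWithinAt_pair {V : Type*} [NormedAddCommGroup V] [NormedSpace ℝ V]
    (θ : DualSection E M F A) {f : V → TotalSpace F A} {s : Set V} {p : V}
    (hf : ContMDiffWithinAt 𝓘(ℝ, V) (𝓘(ℝ, E).prod 𝓘(ℝ, F)) ∞ f s p) :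
    DifferentiableWithinAt ℝ (fun q => θ.pair (f q).1 (f q).2) s p := by
  have h1 := ((contMDiffWithinAt_totalSpace).1 hf).1
  have h2 := θ.contMDiff.contMDiffAt.comp_contMDiffWithinAt p h1
  have h3 := ContMDiffWithinAt.clm_bundle_apply (E₂ := Bundle.Trivial M ℝ) (F₂ := ℝ) h2 hf
  have h4 := ((contMDiffWithinAt_totalSpace).1 h3).2
  exact (h4.contDiffWithinAt).differentiableWithinAt (by simp)

variable (L) in
/-- The anchor, with values in the model space. -/
def LieAlgebroid.anchorVal (v : TotalSpace F A) : E := L.anchor v.1 v.2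

/-- The conditions on a morphism `T I^n → A` at a point only depend on its restriction to a
subset through the point in which derivatives are unique. -/
lemma CubeMorphism.eqs_of_eqOn_subset {n : ℕ} {p : Fin n → ℝ}
    (f : (Fin n → ℝ) → CubeMorphism L n)
    (hf : ∀ k, ContMDiffWithinAt 𝓘(ℝ, Fin n → ℝ) (𝓘(ℝ, E).prod 𝓘(ℝ, F)) ∞
      (fun q => (f q).val k q) (cube n) p)
    (hloc : ∃ t ⊆ cube n, p ∈ t ∧ UniqueDiffWithinAt ℝ t p ∧
      ∀ q ∈ t, ∀ k, (f q).val k q = (f p).val k q) :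
    (∀ k, L.anchor ((f p).base p) ((f p).comp k p)
      = mfderivWithin 𝓘(ℝ, Fin n → ℝ) 𝓘(ℝ, E) (fun q => (f q).base q) (cube n) p
        (Pi.single k (1 : ℝ) : Fin n → ℝ)) ∧
    (∀ i j, i < j → ∀ (θ : DualSection E M F A)
      (X Y : Cₛ^∞⟮𝓘(ℝ, E); F, A⟯), X ((f p).base p) = (f p).comp i p →
      Y ((f p).base p) = (f p).comp j p →
      fderivWithin ℝ (fun q => θ.pair ((f q).base q) ((f q).comp j q)) (cube n) p (Pi.single i 1)
      - fderivWithin ℝ (fun q => θ.pair ((f q).base q) ((f q).comp i q)) (cube n) p (Pi.single j 1)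
        = L.d θ X Y ((f p).base p)) := by
  obtain ⟨t, ht, hp, hu, h⟩ := hloc
  constructor
  · intro k
    have hD : (mfderivWithin 𝓘(ℝ, Fin n → ℝ) 𝓘(ℝ, E) (fun q => (f q).base q) (cube n) p :
        (Fin n → ℝ) →L[ℝ] E) = mfderivWithin 𝓘(ℝ, Fin n → ℝ) 𝓘(ℝ, E) (f p).base (cube n) p :=
      mfderivWithin_eq_of_eqOn_subset ht hp hu
        (((contMDiffWithinAt_totalSpace).1 (hf k)).1.mdifferentiableWithinAt (by simp))
        (((f p).contMDiffOn_base k p (ht hp)).mdifferentiableWithinAt (by simp))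
        fun q hq => congrArg TotalSpace.proj (h q hq k)
    exact ((f p).anchor_eq k p (ht hp)).trans
      (congrArg (fun T : (Fin n → ℝ) →L[ℝ] E => T (Pi.single k 1)) hD).symm
  · intro i j hij θ X Y hX hY
    have hD (k : Fin n) : fderivWithin ℝ (fun q => θ.pair ((f q).base q) ((f q).comp k q))
        (cube n) p = fderivWithin ℝ (fun q => θ.pair ((f p).base q) ((f p).comp k q)) (cube n) p :=
      fderivWithin_eq_of_eqOn_subset ht hp hu (θ.differentiableWithinAt_pair (hf k))
        (θ.differentiableWithinAt_pair ((f p).smooth k p (ht hp)))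
        fun q hq => congrArg (fun v : TotalSpace F A => θ.pair v.1 v.2) (h q hq k)
    rw [hD, hD]
    exact (f p).d_eq i j hij p (ht hp) θ X Y hX hY

/-- Two morphisms `σ`, `σ'` can be glued along the hyperplane `p i = 1/2`, if there is a third
morphism which agrees with `σ` after, and with `σ'` before the hyperplane. -/
theorem CubeMorphism.exists_glue {n : ℕ} (σ σ' η : CubeMorphism L n) (i : Fin n)
    (hσ : ∀ p ∈ cube n, 1 / 2 ≤ p i → ∀ k, σ.val k p = η.val k p)
    (hσ' : ∀ p ∈ cube n, p i ≤ 1 / 2 → ∀ k, σ'.val k p = η.val k p) :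
    ∃ K : CubeMorphism L n, (∀ p ∈ cube n, p i ≤ 1 / 2 → ∀ k, K.val k p = σ.val k p) ∧
      ∀ p ∈ cube n, 1 / 2 ≤ p i → ∀ k, K.val k p = σ'.val k p := by
  classical
  -- The choice depends on the point, and the hyperplane itself is given to `σ`. There `σ` and `σ'`
  -- both agree with `η`, so nothing depends on this convention.
  let f (p : Fin n → ℝ) : CubeMorphism L n := if p i ≤ 1 / 2 then σ else σ'
  have f_le {p : Fin n → ℝ} (hp : p i ≤ 1 / 2) : f p = σ := if_pos hp
  have f_gt {p : Fin n → ℝ} (hp : 1 / 2 < p i) : f p = σ' := if_neg hp.not_ge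
  have v_ge {p : Fin n → ℝ} (hc : p ∈ cube n) (hp : 1 / 2 ≤ p i) (k : Fin n) :
      (f p).val k p = σ'.val k p := by
    rcases hp.eq_or_lt with h | h
    · rw [f_le h.ge, hσ p hc hp, hσ' p hc h.ge]
    · rw [f_gt h]
  have hcoord : Continuous fun q : Fin n → ℝ => q i := continuous_apply i
  have hf : ∀ p ∈ cube n, ∀ k, ContMDiffWithinAt 𝓘(ℝ, Fin n → ℝ) (𝓘(ℝ, E).prod 𝓘(ℝ, F)) ∞
      (fun q => (f q).val k q) (cube n) p := by
    intro p hp k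
    rcases lt_trichotomy (p i) (1 / 2) with h | h | h
    · refine (σ.smooth k p hp).congr_of_eventuallyEq ?_ (by rw [f_le h.le]; rfl)
      filter_upwards [mem_nhdsWithin_of_mem_nhds (hcoord.continuousAt.eventually_lt
        continuousAt_const h)] with q hq
      rw [f_le (le_of_lt hq)]
      rfl
    · refine contMDiffWithinAt_glue hp (σ.smooth k p hp) (σ'.smooth k p hp) (η.smooth k p hp)
        (hσ p hp h.ge k) (hσ' p hp h.le k) fun q hq => ?_
      rcases le_or_gt (q i) (1 / 2) with h | h
      · exact Or.inl ⟨by rw [f_le h]; rfl, hσ' q hq h k⟩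
      · exact Or.inr ⟨by rw [f_gt h]; rfl, hσ q hq h.le k⟩
    · refine (σ'.smooth k p hp).congr_of_eventuallyEq ?_ (by rw [f_gt h]; rfl)
      filter_upwards [mem_nhdsWithin_of_mem_nhds (continuousAt_const.eventually_lt
        hcoord.continuousAt h)] with q hq
      rw [f_gt hq]
      rfl
  have hloc (p : Fin n → ℝ) (hp : p ∈ cube n) : ∃ t ⊆ cube n, p ∈ t ∧ UniqueDiffWithinAt ℝ t p ∧
      ∀ q ∈ t, ∀ k, (f q).val k q = (f p).val k q := by
    rcases le_or_gt (p i) (1 / 2) with h | h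
    · exact ⟨_, inter_subset_left, ⟨hp, h⟩, uniqueDiffOn_cube_inter_le i p ⟨hp, h⟩,
        fun q hq k => by rw [f_le hq.2, f_le h]⟩
    · exact ⟨_, inter_subset_left, ⟨hp, h.le⟩, uniqueDiffOn_cube_inter_ge i p ⟨hp, h.le⟩,
        fun q hq k => by rw [v_ge hq.1 hq.2 k, f_gt h]⟩
  have heqs (p : Fin n → ℝ) (hp : p ∈ cube n) :=
    CubeMorphism.eqs_of_eqOn_subset f (hf p hp) (hloc p hp)
  refine ⟨⟨fun p => (f p).base p, fun k p => (f p).comp k p, fun k p hp => hf p hp k,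
    fun k p hp => (heqs p hp).1 k, fun i j hij p hp => (heqs p hp).2 i j hij⟩, ?_, ?_⟩
  · intro p _ h k
    change (f p).val k p = _
    rw [f_le h]
  · intro p hp h k
    exact v_ge hp h k

end Gluing

/-! ### Derivatives of cut-off functions -/

section Cutoff

/-- Such a `t` is a global minimum of `τ`; this includes the boundary point `0`. -/
lemma IsCutoff.deriv_eq_zero_of_nonpos {τ : ℝ → ℝ} (hτ : IsCutoff τ) {t : ℝ} (ht : t ≤ 0) :
    deriv τ t = 0 := by
  refine IsLocalMin.deriv_eq_zero (Eventually.of_forall fun s => ?_)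
  rw [hτ.eq_zero t ht]
  exact (hτ.mem_Icc s).1

lemma IsCutoff.deriv_eq_zero_of_one_le {τ : ℝ → ℝ} (hτ : IsCutoff τ) {t : ℝ} (ht : 1 ≤ t) :
    deriv τ t = 0 := by
  refine IsLocalMax.deriv_eq_zero (Eventually.of_forall fun s => ?_)
  rw [hτ.eq_one t ht]
  exact (hτ.mem_Icc s).2

lemma IsCutoff.deriv_comp_affine {τ : ℝ → ℝ} (hτ : IsCutoff τ) (a b t : ℝ) :
    deriv (fun t => τ (a * t - b)) t = a * deriv τ (a * t - b) := by
  have h1 : HasDerivAt (fun t : ℝ => a * t - b) a t := by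
    simpa using ((hasDerivAt_id t).const_mul a).sub_const b
  have h2 := ((hτ.smooth.differentiable (by simp) (a * t - b)).hasDerivAt.comp t h1).deriv
  rw [mul_comm]
  exact h2

lemma IsCutoff.deriv_comp_two_mul {τ : ℝ → ℝ} (hτ : IsCutoff τ) (t : ℝ) :
    deriv (fun t => τ (2 * t)) t = 2 * deriv τ (2 * t) := by
  simpa only [sub_zero] using hτ.deriv_comp_affine 2 0 t

end Cutoff

/-! ### Maps that change a single coordinate -/

section Coordinates

lemma jac_eq_fderiv {m n : ℕ} {φ : (Fin m → ℝ) → (Fin n → ℝ)} {p : Fin m → ℝ}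
    (hφ : DifferentiableAt ℝ φ p) (j : Fin m) (k : Fin n) :
    jac φ p j k = fderiv ℝ (fun q => φ q k) p (Pi.single j 1) := by
  rw [(hasFDerivAt_pi'.1 hφ.hasFDerivAt k).fderiv]
  rfl

/-- The map which applies `g` to the `i`-th coordinate. -/
def coordMap {n : ℕ} (i : Fin n) (g : ℝ → ℝ) (p : Fin n → ℝ) : Fin n → ℝ :=
  update p i (g (p i))

lemma contDiff_coordMap {n : ℕ} (i : Fin n) {g : ℝ → ℝ} (hg : ContDiff ℝ ∞ g) :
    ContDiff ℝ ∞ (coordMap i g) := by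
  rw [contDiff_pi]
  intro k
  by_cases h : k = i
  · subst h
    simp only [coordMap, update_self]
    exact hg.comp (contDiff_apply ℝ ℝ k)
  · simp only [coordMap, update_of_ne h]
    exact contDiff_apply ℝ ℝ k

lemma mapsTo_coordMap {n : ℕ} (i : Fin n) {g : ℝ → ℝ} (hg : MapsTo g (Icc 0 1) (Icc 0 1)) :
    MapsTo (coordMap i g) (cube n) (cube n) := by
  intro p hp
  have h : ∀ k, coordMap i g p k ∈ Icc (0 : ℝ) 1 := by
    intro k
    by_cases h : k = i
    · subst h
      simp only [coordMap, update_self]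
      exact hg ⟨hp.1 k, hp.2 k⟩
    · simp only [coordMap, update_of_ne h]
      exact ⟨hp.1 k, hp.2 k⟩
  exact ⟨fun k => (h k).1, fun k => (h k).2⟩

lemma jac_coordMap {n : ℕ} (i : Fin n) {g : ℝ → ℝ} (hg : ContDiff ℝ ∞ g) (p : Fin n → ℝ)
    (j k : Fin n) :
    jac (coordMap i g) p j k = if k = j then (if j = i then deriv g (p i) else 1) else 0 := by
  rw [jac_eq_fderiv ((contDiff_coordMap i hg).differentiable (by simp) p)]
  by_cases h : k = i
  · subst h
    have h1 : HasFDerivAt (fun q : Fin n → ℝ => g (q k)) _ p :=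
      (hg.differentiable (by simp) (p k)).hasDerivAt.comp_hasFDerivAt p
        (hasFDerivAt_apply (𝕜 := ℝ) k p)
    simp only [coordMap, update_self]
    rw [h1.fderiv]
    by_cases h' : k = j
    · subst h'; simp
    · simp [h']
  · simp only [coordMap, update_of_ne h]
    rw [(hasFDerivAt_apply (𝕜 := ℝ) k p).fderiv]
    by_cases h' : k = j
    · subst h'; simp [h]
    · simp [h']

end Coordinates

/-! ### Concatenation of morphisms in a coordinate direction -/

section Concatenation

variable {E : Type*} [NormedAddCommGroup E] [NormedSpace ℝ E]
  {M : Type*} [TopologicalSpace M] [ChartedSpace E M]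
  {F : Type*} [NormedAddCommGroup F] [NormedSpace ℝ F]
  {A : M → Type*} [TopologicalSpace (TotalSpace F A)]
  [∀ x, AddCommGroup (A x)] [∀ x, Module ℝ (A x)] [∀ x, TopologicalSpace (A x)]
  [FiberBundle F A] [VectorBundle ℝ F A]

lemma scale_zero_congr {v w : TotalSpace F A} (h : v.1 = w.1) : scale 0 v = scale 0 w := by
  obtain ⟨x, v⟩ := v
  obtain ⟨y, w⟩ := w
  obtain rfl : x = y := h
  simp [scale]

lemma scale_scale (r s : ℝ) (v : TotalSpace F A) : scale r (scale s v) = scale (r * s) v := by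
  simp only [scale, mul_smul]
  rfl

variable [IsManifold 𝓘(ℝ, E) ∞ M] [ContMDiffVectorBundle ∞ F A 𝓘(ℝ, E)]
  {L : LieAlgebroid E M F A}
  [FiniteDimensional ℝ E] [FiniteDimensional ℝ F] [T2Space M]

/-- The reparametrization of one of the coordinates of a morphism `T I^n → A`. -/
def CubeMorphism.reparam {n : ℕ} [NeZero n] (σ : CubeMorphism L n) (i : Fin n) (g : ℝ → ℝ)
    (hg : ContDiff ℝ ∞ g) (hm : MapsTo g (Icc 0 1) (Icc 0 1)) : CubeMorphism L n :=
  σ.pull (coordMap i g) (contDiff_coordMap i hg) (mapsTo_coordMap i hm)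

lemma CubeMorphism.reparam_val_self {n : ℕ} [NeZero n] (σ : CubeMorphism L n) (i : Fin n)
    {g : ℝ → ℝ} (hg : ContDiff ℝ ∞ g) (hm : MapsTo g (Icc 0 1) (Icc 0 1)) (p : Fin n → ℝ) :
    (σ.reparam i g hg hm).val i p = scale (deriv g (p i)) (σ.val i (update p i (g (p i)))) := by
  rw [CubeMorphism.reparam, CubeMorphism.pull_val]
  simp only [jac_coordMap i hg, if_true, ite_smul, zero_smul, Finset.sum_ite_eq', Finset.mem_univ]
  rfl

lemma CubeMorphism.reparam_val_of_ne {n : ℕ} [NeZero n] (σ : CubeMorphism L n) (i : Fin n)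
    {g : ℝ → ℝ} (hg : ContDiff ℝ ∞ g) (hm : MapsTo g (Icc 0 1) (Icc 0 1)) (p : Fin n → ℝ)
    {k : Fin n} (hk : k ≠ i) :
    (σ.reparam i g hg hm).val k p = σ.val k (update p i (g (p i))) := by
  rw [CubeMorphism.reparam, CubeMorphism.pull_val]
  simp only [jac_coordMap i hg, ite_smul, zero_smul, Finset.sum_ite_eq', Finset.mem_univ,
    if_true, if_neg hk, one_smul]
  rfl

/-- Concatenation of two morphisms `T I^n → A` in the direction of the `i`-th coordinate, after
reparametrization by a cut-off function. -/
theorem CubeMorphism.exists_concat {n : ℕ} [NeZero n] (H H' : CubeMorphism L n) (i : Fin n)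
    {τ : ℝ → ℝ} (hτ : IsCutoff τ)
    (hb : ∀ p ∈ cube n, H.base (update p i 1) = H'.base (update p i 0))
    (hc : ∀ p ∈ cube n, ∀ k, k ≠ i → H.val k (update p i 1) = H'.val k (update p i 0)) :
    ∃ K : CubeMorphism L n,
      (∀ p ∈ cube n, p i ≤ 1 / 2 →
        K.val i p = scale (2 * deriv τ (2 * p i)) (H.val i (update p i (τ (2 * p i)))) ∧
        ∀ k, k ≠ i → K.val k p = H.val k (update p i (τ (2 * p i)))) ∧
      (∀ p ∈ cube n, 1 / 2 ≤ p i →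
        K.val i p = scale (2 * deriv τ (2 * p i - 1)) (H'.val i (update p i (τ (2 * p i - 1)))) ∧
        ∀ k, k ≠ i → K.val k p = H'.val k (update p i (τ (2 * p i - 1)))) := by
  have hs (b : ℝ) : ContDiff ℝ ∞ fun t => τ (2 * t - b) :=
    hτ.smooth.comp ((contDiff_const.mul contDiff_id).sub contDiff_const)
  have hmaps (b : ℝ) : MapsTo (fun t => τ (2 * t - b)) (Icc 0 1) (Icc 0 1) :=
    fun t _ => hτ.mem_Icc _
  -- Reparametrization by the constant `1` gives the third morphism needed for gluing: `H` frozen on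
  -- its last face, with vanishing `i`-th component. The `i`-th components of `H` and `H'` need not
  -- match, since the cut-off multiplies them by zero at the seam.
  have hone : MapsTo (fun _ : ℝ => (1 : ℝ)) (Icc 0 1) (Icc 0 1) := fun _ _ => by simp
  have hA : ∀ p ∈ cube n, 1 / 2 ≤ p i → ∀ k,
      (H.reparam i (fun t => τ (2 * t - 0)) (hs 0) (hmaps 0)).val k p
        = (H.reparam i (fun _ => 1) contDiff_const hone).val k p := by
    intro p hp h k
    have hle : (1 : ℝ) ≤ 2 * p i - 0 := by linarith
    by_cases hk : k = i
    · subst hk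
      rw [H.reparam_val_self, H.reparam_val_self, hτ.deriv_comp_affine,
        hτ.deriv_eq_zero_of_one_le hle, hτ.eq_one _ hle]
      simp
    · rw [H.reparam_val_of_ne _ _ _ _ hk, H.reparam_val_of_ne _ _ _ _ hk, hτ.eq_one _ hle]
  have hB : ∀ p ∈ cube n, p i ≤ 1 / 2 → ∀ k,
      (H'.reparam i (fun t => τ (2 * t - 1)) (hs 1) (hmaps 1)).val k p
        = (H.reparam i (fun _ => 1) contDiff_const hone).val k p := by
    intro p hp h k
    have hle : 2 * p i - 1 ≤ (0 : ℝ) := by linarith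
    by_cases hk : k = i
    · subst hk
      rw [H'.reparam_val_self, H.reparam_val_self, hτ.deriv_comp_affine,
        hτ.deriv_eq_zero_of_nonpos hle, hτ.eq_zero _ hle]
      simp only [mul_zero, deriv_const]
      exact scale_zero_congr (hb p hp).symm
    · rw [H'.reparam_val_of_ne _ _ _ _ hk, H.reparam_val_of_ne _ _ _ _ hk, hτ.eq_zero _ hle]
      exact (hc p hp k hk).symm
  obtain ⟨K, h1, h2⟩ := CubeMorphism.exists_glue _ _ _ i hA hB
  refine ⟨K, fun p hp h => ⟨?_, fun k hk => ?_⟩, fun p hp h => ⟨?_, fun k hk => ?_⟩⟩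
  · rw [h1 p hp h, H.reparam_val_self, hτ.deriv_comp_affine]
    simp only [sub_zero]
  · rw [h1 p hp h, H.reparam_val_of_ne _ _ _ _ hk]
    simp only [sub_zero]
  · rw [h2 p hp h, H'.reparam_val_self, hτ.deriv_comp_affine]
  · rw [h2 p hp h, H'.reparam_val_of_ne _ _ _ _ hk]

end Concatenation

/-! ### Maps with vanishing derivative -/

section Constant

variable {E : Type*} [NormedAddCommGroup E] [NormedSpace ℝ E]
  {M : Type*} [TopologicalSpace M] [ChartedSpace E M] [IsManifold 𝓘(ℝ, E) ∞ M]

/-- A map from a convex set to a manifold is constant, if its derivative vanishes. -/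
lemma eq_of_hasMFDerivWithinAt_zero {V : Type*} [NormedAddCommGroup V] [NormedSpace ℝ V]
    {f : V → M} {s : Set V} (hs : Convex ℝ s)
    (hf : ∀ p ∈ s, HasMFDerivWithinAt 𝓘(ℝ, V) 𝓘(ℝ, E) f s p (0 : V →L[ℝ] E))
    {p q : V} (hp : p ∈ s) (hq : q ∈ s) : f p = f q := by
  have : PreconnectedSpace s := Subtype.preconnectedSpace hs.isPreconnected
  have hloc : IsLocallyConstant fun x : s => f x := by
    rw [IsLocallyConstant.iff_eventually_eq]
    rintro ⟨x, hx⟩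
    let e := extChartAt 𝓘(ℝ, E) (f x)
    have hev : ∀ᶠ y in 𝓝[s] x, f y ∈ e.source :=
      (hf x hx).continuousWithinAt.eventually (extChartAt_source_mem_nhds (f x))
    -- The intersection of the ball with `s` is convex and is mapped into one chart, so the mean
    -- value inequality with constant `0` applies.
    obtain ⟨ε, hε, hball⟩ := Metric.mem_nhdsWithin_iff.1 hev
    have hx' : x ∈ Metric.ball x ε ∩ s := ⟨Metric.mem_ball_self hε, hx⟩
    have hder : ∀ y ∈ Metric.ball x ε ∩ s,
        HasFDerivWithinAt (fun z => e (f z)) (0 : V →L[ℝ] E) (Metric.ball x ε ∩ s) y := by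
      intro y hy
      have h1 := (hf y hy.2).mono (inter_subset_right (s := Metric.ball x ε))
      have hsrc : f y ∈ (chartAt E (f x)).source := by
        rw [← extChartAt_source 𝓘(ℝ, E)]
        exact hball hy
      have h2 := ((contMDiffAt_extChartAt' (I := 𝓘(ℝ, E)) (n := ∞) hsrc).mdifferentiableAt
        (by simp)).hasMFDerivAt.comp_hasMFDerivWithinAt y h1
      refine h2.hasFDerivWithinAt.congr_fderiv ?_
      ext v
      exact map_zero (mfderiv 𝓘(ℝ, E) 𝓘(ℝ, E) e (f y))
    have hconst : ∀ y ∈ Metric.ball x ε ∩ s, f y = f x := by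
      intro y hy
      have h := ((convex_ball x ε).inter hs).norm_image_sub_le_of_norm_hasFDerivWithin_le (C := 0)
        hder (fun z _ => by simp) hx' hy
      rw [zero_mul, norm_le_zero_iff, sub_eq_zero] at h
      exact e.injOn (hball hy) (hball hx') h
    have : Metric.ball x ε ∩ s ∈ 𝓝[s] x := 
      inter_mem (mem_nhdsWithin_of_mem_nhds (Metric.ball_mem_nhds x hε)) self_mem_nhdsWithin
    have h2 : ∀ᶠ y in 𝓝[s] x, f y = f x := Filter.mem_of_superset this hconst
    rw [nhdsWithin_eq_map_subtype_coe hx] at h2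
    exact h2
  exact hloc.apply_eq_of_preconnectedSpace ⟨p, hp⟩ ⟨q, hq⟩

end Constant

/-! ### Points of low-dimensional cubes and standard reparametrizations -/

section Vectors

lemma mem_cube_iff {n : ℕ} {p : Fin n → ℝ} : p ∈ cube n ↔ ∀ k, p k ∈ Icc (0 : ℝ) 1 :=
  ⟨fun h k => ⟨h.1 k, h.2 k⟩, fun h => ⟨fun k => (h k).1, fun k => (h k).2⟩⟩

lemma vec_one_mem_cube {t : ℝ} (ht : t ∈ Icc (0 : ℝ) 1) : ![t] ∈ cube 1 :=
  mem_cube_iff.2 fun k => by fin_cases k; exact ht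

lemma vec_two_mem_cube {t s : ℝ} (ht : t ∈ Icc (0 : ℝ) 1) (hs : s ∈ Icc (0 : ℝ) 1) :
    ![t, s] ∈ cube 2 :=
  mem_cube_iff.2 fun k => by fin_cases k; exacts [ht, hs]

lemma vec_three_mem_cube {t s u : ℝ} (ht : t ∈ Icc (0 : ℝ) 1) (hs : s ∈ Icc (0 : ℝ) 1)
    (hu : u ∈ Icc (0 : ℝ) 1) : ![t, s, u] ∈ cube 3 :=
  mem_cube_iff.2 fun k => by fin_cases k; exacts [ht, hs, hu]

lemma update_vec_one (t c : ℝ) : update ![t] 0 c = ![c] := by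
  funext k; fin_cases k; rfl

lemma update_vec_two_zero (t s c : ℝ) : update ![t, s] 0 c = ![c, s] := by
  funext k; fin_cases k <;> rfl

lemma update_vec_two_one (t s c : ℝ) : update ![t, s] 1 c = ![t, c] := by
  funext k; fin_cases k <;> rfl

lemma update_vec_three_two (t s u c : ℝ) : update ![t, s, u] 2 c = ![t, s, c] := by
  funext k; fin_cases k <;> rfl

lemma eq_vec_one (p : Fin 1 → ℝ) : p = ![p 0] := by
  funext k; fin_cases k; rfl

lemma eq_vec_two (p : Fin 2 → ℝ) : p = ![p 0, p 1] := by
  funext k; fin_cases k <;> rfl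

lemma eq_vec_three (p : Fin 3 → ℝ) : p = ![p 0, p 1, p 2] := by
  funext k; fin_cases k <;> rfl

/-- The cut-off function which is used in constructions. -/
lemma isCutoff_smoothTransition : IsCutoff Real.smoothTransition where
  smooth := Real.smoothTransition.contDiff
  mem_Icc t := ⟨Real.smoothTransition.nonneg t, Real.smoothTransition.le_one t⟩
  eq_zero _ ht := Real.smoothTransition.zero_of_nonpos ht
  eq_one _ ht := Real.smoothTransition.one_of_one_le ht

lemma hasDerivAt_one_sub (t : ℝ) : HasDerivAt (fun t : ℝ => 1 - t) (-1) t := by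
  simpa using (hasDerivAt_id t).const_sub 1

lemma contDiff_one_sub : ContDiff ℝ ∞ fun t : ℝ => 1 - t := contDiff_const.sub contDiff_id

lemma mapsTo_one_sub : MapsTo (fun t : ℝ => 1 - t) (Icc 0 1) (Icc 0 1) :=
  fun t ht => ⟨by linarith [ht.2], by linarith [ht.1]⟩

end Vectors

/-! ### Thin and ordinary homotopies of paths -/

section Homotopies

variable {E : Type*} [NormedAddCommGroup E] [NormedSpace ℝ E]
  {M : Type*} [TopologicalSpace M] [ChartedSpace E M]
  {F : Type*} [NormedAddCommGroup F] [NormedSpace ℝ F]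
  {A : M → Type*} [TopologicalSpace (TotalSpace F A)]
  [∀ x, AddCommGroup (A x)] [∀ x, Module ℝ (A x)] [∀ x, TopologicalSpace (A x)]
  [FiberBundle F A] [VectorBundle ℝ F A]

lemma scale_one (v : TotalSpace F A) : scale 1 v = v := by
  simp [scale]

lemma scale_snd_eq_zero {r : ℝ} {v w : TotalSpace F A} (h : v = scale r w) (hw : w.2 = 0) :
    v.2 = 0 := by
  subst h
  change r • w.2 = 0
  rw [hw, smul_zero]

/-- Bilinearity of the wedge product, so thinness survives rescaling of the components. The casts
are there because the vectors are points of the total space whose base points are only provably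
equal. -/
lemma wedge_eq_zero_of_scale {v w v' w' : TotalSpace F A} (hvw : v.1 = w.1) (hvw' : v'.1 = w'.1)
    {r s : ℝ} (hv : v = scale r v') (hw : w = scale s w')
    (h : ExteriorAlgebra.ι ℝ (hvw' ▸ v'.2 : A w'.1) * ExteriorAlgebra.ι ℝ w'.2 = 0) :
    ExteriorAlgebra.ι ℝ (hvw ▸ v.2 : A w.1) * ExteriorAlgebra.ι ℝ w.2 = 0 := by
  obtain ⟨x, v'⟩ := v'
  obtain ⟨y, w'⟩ := w'
  obtain rfl : x = y := hvw'
  subst hv hw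
  change ExteriorAlgebra.ι ℝ (r • v') * ExteriorAlgebra.ι ℝ (s • w') = 0
  rw [map_smul, map_smul, smul_mul_smul_comm, h, smul_zero]

variable [IsManifold 𝓘(ℝ, E) ∞ M] {L : LieAlgebroid E M F A}

/-- Homotopies of `A`-paths, which have to be thin if `P` holds. This treats `A`-homotopies and
thin homotopies at the same time. -/
def Homotopic (P : Prop) {x y : M} (a₀ a₁ : APath L x y) : Prop :=
  ∃ σ : AHomotopy a₀ a₁, P → σ.IsThin

lemma homotopic_true_iff {x y : M} {a₀ a₁ : APath L x y} :
    Homotopic True a₀ a₁ ↔ ThinHomotopic L a₀ a₁ := by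
  simp [Homotopic, ThinHomotopic]

lemma homotopic_false_iff {x y : M} {a₀ a₁ : APath L x y} :
    Homotopic False a₀ a₁ ↔ AHomotopic L a₀ a₁ := by
  simp [Homotopic, AHomotopic]

/-- On the set `s` of parameters, the path `a` is the reparametrization `f'(t) c(f(t)) dt`. -/
def PullsOn (s : Set ℝ) (f : ℝ → ℝ) {x y z w : M} (a : APath L x y) (c : APath L z w) : Prop :=
  ∀ t ∈ s, a.at t = scale (deriv f t) (c.at (f t))

lemma PullsOn.comp {s s' : Set ℝ} {f g : ℝ → ℝ} {x y z w x' y' : M} {a : APath L x y}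
    {b : APath L z w} {c : APath L x' y'} (h : PullsOn s f a b) (h' : PullsOn s' g b c)
    (hf : ContDiff ℝ ∞ f) (hg : ContDiff ℝ ∞ g) (hm : MapsTo f s s') :
    PullsOn s (fun t => g (f t)) a c := by
  intro t ht
  have hd : deriv (fun t => g (f t)) t = deriv f t * deriv g (f t) := by
    rw [mul_comm]
    exact ((hg.differentiable (by simp) (f t)).hasDerivAt.comp t
      (hf.differentiable (by simp) t).hasDerivAt).deriv
  rw [h t ht, h' _ (hm ht), scale_scale, hd]

lemma CubeMorphism.wedge_eq_zero {m n : ℕ} {K : CubeMorphism L m} {σ : CubeMorphism L n}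
    {i j : Fin m} {i' j' : Fin n} {p : Fin m → ℝ} {q : Fin n → ℝ} {r s : ℝ}
    (h0 : K.val i p = scale r (σ.val i' q)) (h1 : K.val j p = scale s (σ.val j' q))
    (h : ExteriorAlgebra.ι ℝ (σ.comp i' q) * ExteriorAlgebra.ι ℝ (σ.comp j' q) = 0) :
    ExteriorAlgebra.ι ℝ (K.comp i p) * ExteriorAlgebra.ι ℝ (K.comp j p) = 0 :=
  wedge_eq_zero_of_scale (v := K.val i p) (w := K.val j p) (v' := σ.val i' q) (w' := σ.val j' q)
    rfl rfl h0 h1 h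

variable [ContMDiffVectorBundle ∞ F A 𝓘(ℝ, E)]
  [FiniteDimensional ℝ E] [FiniteDimensional ℝ F] [T2Space M]

/-- Reversal of the parameter `s`; it changes `b` by a sign, which does not affect thinness. -/
lemma Homotopic.symm {P : Prop} {x y : M} {a₀ a₁ : APath L x y} (h : Homotopic P a₀ a₁) :
    Homotopic P a₁ a₀ := by
  obtain ⟨σ, hσ⟩ := h
  let K := σ.reparam 1 (fun t => 1 - t) contDiff_one_sub mapsTo_one_sub
  have hK0 (t s : ℝ) : K.val 0 ![t, s] = σ.val 0 ![t, 1 - s] := by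
    have := σ.reparam_val_of_ne 1 contDiff_one_sub mapsTo_one_sub ![t, s] (k := 0) (by simp)
    rwa [update_vec_two_one] at this
  have hK1 (t s : ℝ) : K.val 1 ![t, s] = scale (-1) (σ.val 1 ![t, 1 - s]) := by
    have := σ.reparam_val_self 1 contDiff_one_sub mapsTo_one_sub ![t, s]
    rwa [update_vec_two_one, (hasDerivAt_one_sub _).deriv] at this
  refine ⟨⟨K, fun t ht => ?_, fun t ht => ?_, fun s hs => ?_, fun s hs => ?_⟩, fun hP p hp => ?_⟩
  · rw [hK0, sub_zero, σ.target_eq t ht]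
  · rw [hK0, sub_self, σ.source_eq t ht]
  · exact scale_snd_eq_zero (hK1 0 s) (σ.b_zero _ (mapsTo_one_sub hs))
  · exact scale_snd_eq_zero (hK1 1 s) (σ.b_one _ (mapsTo_one_sub hs))
  · have hp' := mem_cube_iff.1 hp
    rw [eq_vec_two p]
    exact CubeMorphism.wedge_eq_zero (r := 1) ((hK0 _ _).trans (scale_one _).symm) (hK1 _ _)
      (hσ hP _ (vec_two_mem_cube (hp' 0) (mapsTo_one_sub (hp' 1))))

/-- Concatenation in the direction of `s`. Only the `a`-components must match at the seam, and there
both equal the middle path. -/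
lemma Homotopic.trans {P : Prop} {x y : M} {a₀ a₁ a₂ : APath L x y} (h : Homotopic P a₀ a₁)
    (h' : Homotopic P a₁ a₂) : Homotopic P a₀ a₂ := by
  obtain ⟨σ, hσ⟩ := h
  obtain ⟨σ', hσ'⟩ := h'
  have hτ := isCutoff_smoothTransition
  set τ := Real.smoothTransition
  have hmatch : ∀ p ∈ cube 2, σ.val 0 (update p 1 1) = σ'.val 0 (update p 1 0) := by
    intro p hp
    rw [eq_vec_two p, update_vec_two_one, update_vec_two_one]
    have ht := mem_cube_iff.1 hp 0
    exact (σ.target_eq _ ht).trans (σ'.source_eq _ ht).symm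
  obtain ⟨K, h1, h2⟩ := CubeMorphism.exists_concat σ.toCubeMorphism σ'.toCubeMorphism 1 hτ
    (fun p hp => congrArg TotalSpace.proj (hmatch p hp)) fun p hp k hk => by
      obtain rfl : k = 0 := by fin_cases k <;> simp_all
      exact hmatch p hp
  have hK {t s : ℝ} (ht : t ∈ Icc (0 : ℝ) 1) (hs : s ∈ Icc (0 : ℝ) 1) (h : s ≤ 1 / 2) :
      K.val 0 ![t, s] = σ.val 0 ![t, τ (2 * s)] ∧
      K.val 1 ![t, s] = scale (2 * deriv τ (2 * s)) (σ.val 1 ![t, τ (2 * s)]) := by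
    have := h1 _ (vec_two_mem_cube ht hs) h
    rw [update_vec_two_one] at this
    exact ⟨this.2 0 (by simp), this.1⟩
  have hK' {t s : ℝ} (ht : t ∈ Icc (0 : ℝ) 1) (hs : s ∈ Icc (0 : ℝ) 1) (h : 1 / 2 ≤ s) :
      K.val 0 ![t, s] = σ'.val 0 ![t, τ (2 * s - 1)] ∧
      K.val 1 ![t, s] = scale (2 * deriv τ (2 * s - 1)) (σ'.val 1 ![t, τ (2 * s - 1)]) := by
    have := h2 _ (vec_two_mem_cube ht hs) h
    rw [update_vec_two_one] at this
    exact ⟨this.2 0 (by simp), this.1⟩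
  have z0 : (0 : ℝ) ∈ Icc (0 : ℝ) 1 := by simp
  have z1 : (1 : ℝ) ∈ Icc (0 : ℝ) 1 := by simp
  refine ⟨⟨K, fun t ht => ?_, fun t ht => ?_, fun s hs => ?_, fun s hs => ?_⟩, fun hP p hp => ?_⟩
  · rw [(hK ht z0 (by norm_num)).1, hτ.eq_zero _ (by norm_num), σ.source_eq t ht]
  · rw [(hK' ht z1 (by norm_num)).1, hτ.eq_one _ (by norm_num), σ'.target_eq t ht]
  · rcases le_total s (1 / 2) with h | h
    · exact scale_snd_eq_zero (hK z0 hs h).2 (σ.b_zero _ (hτ.mem_Icc _))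
    · exact scale_snd_eq_zero (hK' z0 hs h).2 (σ'.b_zero _ (hτ.mem_Icc _))
  · rcases le_total s (1 / 2) with h | h
    · exact scale_snd_eq_zero (hK z1 hs h).2 (σ.b_one _ (hτ.mem_Icc _))
    · exact scale_snd_eq_zero (hK' z1 hs h).2 (σ'.b_one _ (hτ.mem_Icc _))
  · have hp' := mem_cube_iff.1 hp
    rw [eq_vec_two p]
    rcases le_total (p 1) (1 / 2) with h | h
    · have := hK (hp' 0) (hp' 1) h
      exact CubeMorphism.wedge_eq_zero (r := 1) (this.1.trans (scale_one _).symm) this.2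
        (hσ hP _ (vec_two_mem_cube (hp' 0) (hτ.mem_Icc _)))
    · have := hK' (hp' 0) (hp' 1) h
      exact CubeMorphism.wedge_eq_zero (r := 1) (this.1.trans (scale_one _).symm) this.2
        (hσ' hP _ (vec_two_mem_cube (hp' 0) (hτ.mem_Icc _)))

/-- Two reparametrizations, with the same end points, of a path are thin homotopic. -/
lemma homotopic_of_pullsOn {P : Prop} {x y z w : M} {a b : APath L x y} (c : APath L z w)
    {f g : ℝ → ℝ} (hf : ContDiff ℝ ∞ f) (hg : ContDiff ℝ ∞ g)
    (hfm : MapsTo f (Icc 0 1) (Icc 0 1)) (hgm : MapsTo g (Icc 0 1) (Icc 0 1))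
    (h0 : f 0 = g 0) (h1 : f 1 = g 1)
    (ha : PullsOn (Icc 0 1) f a c) (hb : PullsOn (Icc 0 1) g b c) : Homotopic P a b := by
  -- Linear interpolation from `f` to `g`; its values stay in the interval by convexity.
  let φ (p : Fin 2 → ℝ) : Fin 1 → ℝ := fun _ => (1 - p 1) * f (p 0) + p 1 * g (p 0)
  have hc (k : Fin 2) : ContDiff ℝ ∞ fun p : Fin 2 → ℝ => p k := contDiff_apply ℝ ℝ k
  have hφ : ContDiff ℝ ∞ φ := contDiff_pi.2 fun _ =>
    ((contDiff_const.sub (hc 1)).mul (hf.comp (hc 0))).add ((hc 1).mul (hg.comp (hc 0)))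
  have hm : MapsTo φ (cube 2) (cube 1) := by
    intro p hp
    have hp' := mem_cube_iff.1 hp
    refine mem_cube_iff.2 fun _ => ?_
    exact convex_Icc (0 : ℝ) 1 (hfm (hp' 0)) (hgm (hp' 0)) (sub_nonneg.2 (hp' 1).2) (hp' 1).1
      (by ring)
  have hjac (p : Fin 2 → ℝ) : jac φ p 0 0 = (1 - p 1) * deriv f (p 0) + p 1 * deriv g (p 0) ∧
      jac φ p 1 0 = g (p 0) - f (p 0) := by
    have hk (k : Fin 2) := hasFDerivAt_apply (𝕜 := ℝ) (F' := fun _ => ℝ) k p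
    have hf' := (hf.differentiable (by simp) (p 0)).hasDerivAt.comp_hasFDerivAt p (hk 0)
    have hg' := (hg.differentiable (by simp) (p 0)).hasDerivAt.comp_hasFDerivAt p (hk 0)
    have hd : HasFDerivAt (fun p => φ p 0) _ p := (((hk 1).const_sub 1).mul hf').add ((hk 1).mul hg')
    rw [jac_eq_fderiv (hφ.differentiable (by simp) p), jac_eq_fderiv (hφ.differentiable (by simp) p),
      hd.fderiv]
    constructor
    · simp
    · simp; ring
  let K := c.pull φ hφ hm
  have hφv (p : Fin 2 → ℝ) : φ p = ![φ p 0] := eq_vec_one _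
  have hK0 (p : Fin 2 → ℝ) : K.val 0 p = scale ((1 - p 1) * deriv f (p 0) + p 1 * deriv g (p 0))
      (c.at ((1 - p 1) * f (p 0) + p 1 * g (p 0))) := by
    rw [← (hjac p).1]
    change (⟨c.base (φ p), ∑ k, jac φ p 0 k • c.comp k (φ p)⟩ : TotalSpace F A) = _
    rw [Fin.sum_univ_one, hφv]
    rfl
  -- The coefficient `g - f` vanishes at both ends, which is the boundary condition on `b`.
  have hK1 (p : Fin 2 → ℝ) : K.val 1 p = scale (g (p 0) - f (p 0))
      (c.at ((1 - p 1) * f (p 0) + p 1 * g (p 0))) := by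
    rw [← (hjac p).2]
    change (⟨c.base (φ p), ∑ k, jac φ p 1 k • c.comp k (φ p)⟩ : TotalSpace F A) = _
    rw [Fin.sum_univ_one, hφv]
    rfl
  refine ⟨⟨K, fun t ht => ?_, fun t ht => ?_, fun s hs => ?_, fun s hs => ?_⟩, fun hP p hp => ?_⟩
  · rw [ha t ht, hK0]
    simp
  · rw [hb t ht, hK0]
    simp
  · have h := hK1 ![0, s]
    simp only [Matrix.cons_val_zero, h0, sub_self] at h
    change (K.val 1 ![0, s]).2 = 0
    rw [h]
    exact zero_smul ℝ _
  · have h := hK1 ![1, s]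
    simp only [Matrix.cons_val_zero, h1, sub_self] at h
    change (K.val 1 ![1, s]).2 = 0
    rw [h]
    exact zero_smul ℝ _
  -- Both components are multiples of the same vector of `c`.
  · exact CubeMorphism.wedge_eq_zero (hK0 p) (hK1 p) (ExteriorAlgebra.ι_sq_zero _)

/-- Paths with the same values on the interval need not be equal as structures, since their data
outside it are arbitrary. The identity reparametrization relates them. -/
lemma homotopic_of_at_eq {P : Prop} {x y : M} {a b : APath L x y}
    (h : ∀ t ∈ Icc (0 : ℝ) 1, a.at t = b.at t) : Homotopic P a b := by
  refine homotopic_of_pullsOn b contDiff_id contDiff_id (mapsTo_id _) (mapsTo_id _) rfl rfl ?_ ?_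
  · intro t ht
    rw [deriv_id, scale_one, h t ht, id]
  · intro t ht
    rw [deriv_id, scale_one, id]

lemma Homotopic.refl {P : Prop} {x y : M} (a : APath L x y) : Homotopic P a a :=
  homotopic_of_at_eq fun _ _ => rfl

end Homotopies

/-! ### 3-homotopy is an equivalence relation -/

section ThreeHomotopies

variable {E : Type*} [NormedAddCommGroup E] [NormedSpace ℝ E]
  {M : Type*} [TopologicalSpace M] [ChartedSpace E M]
  {F : Type*} [NormedAddCommGroup F] [NormedSpace ℝ F]
  {A : M → Type*} [TopologicalSpace (TotalSpace F A)]
  [∀ x, AddCommGroup (A x)] [∀ x, Module ℝ (A x)] [∀ x, TopologicalSpace (A x)]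
  [FiberBundle F A] [VectorBundle ℝ F A]
  [IsManifold 𝓘(ℝ, E) ∞ M] {L : LieAlgebroid E M F A} [ContMDiffVectorBundle ∞ F A 𝓘(ℝ, E)]
  [FiniteDimensional ℝ E] [FiniteDimensional ℝ F] [T2Space M]

/-- The pullback along the projection which forgets `u`. -/
lemma ThreeHomotopic.refl {x y : M} (σ : TotalAHomotopy L x y) : ThreeHomotopic L σ σ := by
  let φ : (Fin 3 → ℝ) →L[ℝ] (Fin 2 → ℝ) :=
    ContinuousLinearMap.pi fun k => ContinuousLinearMap.proj k.castSucc
  have hm : MapsTo φ (cube 3) (cube 2) := fun p hp =>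
    mem_cube_iff.2 fun k => mem_cube_iff.1 hp k.castSucc
  let H := σ.hom.pull φ φ.contDiff hm
  have hjac (p : Fin 3 → ℝ) (j : Fin 3) (k : Fin 2) :
      jac φ p j k = if j = k.castSucc then 1 else 0 := by
    change fderiv ℝ φ p (Pi.single j 1) k = _
    rw [φ.fderiv]
    change (Pi.single j (1 : ℝ) : Fin 3 → ℝ) k.castSucc = _
    rw [Pi.single_apply]
    simp only [eq_comm]
  have hφv (t s u : ℝ) : φ ![t, s, u] = ![t, s] := by
    funext k
    fin_cases k <;> rfl
  have hH0 (t s u : ℝ) : H.val 0 ![t, s, u] = σ.hom.val 0 ![t, s] := by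
    change (⟨_, ∑ k, jac φ _ 0 k • σ.hom.comp k (φ ![t, s, u])⟩ : TotalSpace F A) = _
    rw [Fin.sum_univ_two, hjac, hjac, hφv]
    simp
    rfl
  have hH1 (t s u : ℝ) : H.val 1 ![t, s, u] = σ.hom.val 1 ![t, s] := by
    change (⟨_, ∑ k, jac φ _ 1 k • σ.hom.comp k (φ ![t, s, u])⟩ : TotalSpace F A) = _
    rw [Fin.sum_univ_two, hjac, hjac, hφv]
    simp
    rfl
  have hH2 (p : Fin 3 → ℝ) : H.comp 2 p = 0 := by
    change ∑ k, jac φ p 2 k • σ.hom.comp k (φ p) = 0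
    refine Finset.sum_eq_zero fun k _ => ?_
    rw [hjac, if_neg, zero_smul]
    fin_cases k <;> simp
  exact ⟨H, fun _ _ _ _ => ⟨hH2 _, hH2 _⟩, fun _ _ _ _ => ⟨hH2 _, hH2 _⟩,
    fun _ _ _ _ => ⟨hH0 _ _ _, hH1 _ _ _⟩, fun _ _ _ _ => ⟨hH0 _ _ _, hH1 _ _ _⟩⟩

lemma ThreeHomotopic.symm {x y : M} {σ₀ σ₁ : TotalAHomotopy L x y} (h : ThreeHomotopic L σ₀ σ₁) :
    ThreeHomotopic L σ₁ σ₀ := by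
  obtain ⟨H, ht, hs, h0, h1⟩ := h
  let K := H.reparam 2 (fun t => 1 - t) contDiff_one_sub mapsTo_one_sub
  have hK (t s u : ℝ) (k : Fin 3) (hk : k ≠ 2) : K.val k ![t, s, u] = H.val k ![t, s, 1 - u] := by
    have := H.reparam_val_of_ne 2 contDiff_one_sub mapsTo_one_sub ![t, s, u] hk
    rwa [update_vec_three_two] at this
  have hK2 (t s u : ℝ) : K.val 2 ![t, s, u] = scale (-1) (H.val 2 ![t, s, 1 - u]) := by
    have := H.reparam_val_self 2 contDiff_one_sub mapsTo_one_sub ![t, s, u]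
    rwa [update_vec_three_two, (hasDerivAt_one_sub _).deriv] at this
  refine ⟨K, fun s hs' u hu => ⟨?_, ?_⟩, fun t ht' u hu => ⟨?_, ?_⟩, fun t ht' s hs' => ?_,
    fun t ht' s hs' => ?_⟩
  · exact scale_snd_eq_zero (hK2 _ _ _) (ht s hs' _ (mapsTo_one_sub hu)).1
  · exact scale_snd_eq_zero (hK2 _ _ _) (ht s hs' _ (mapsTo_one_sub hu)).2
  · exact scale_snd_eq_zero (hK2 _ _ _) (hs t ht' _ (mapsTo_one_sub hu)).1
  · exact scale_snd_eq_zero (hK2 _ _ _) (hs t ht' _ (mapsTo_one_sub hu)).2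
  · rw [hK _ _ _ 0 (by simp), hK _ _ _ 1 (by simp), sub_zero]
    exact h1 t ht' s hs'
  · rw [hK _ _ _ 0 (by simp), hK _ _ _ 1 (by simp), sub_self]
    exact h0 t ht' s hs'

/-- Concatenation in the direction of `u`. The components matched at the seam are those of `σ₁`; the
vanishing of `H₃` on the sides survives rescaling. -/
lemma ThreeHomotopic.trans {x y : M} {σ₀ σ₁ σ₂ : TotalAHomotopy L x y}
    (h : ThreeHomotopic L σ₀ σ₁) (h' : ThreeHomotopic L σ₁ σ₂) : ThreeHomotopic L σ₀ σ₂ := by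
  obtain ⟨H, ht, hs, h0, h1⟩ := h
  obtain ⟨H', ht', hs', h0', h1'⟩ := h'
  have hτ := isCutoff_smoothTransition
  set τ := Real.smoothTransition
  have hmatch : ∀ p ∈ cube 3, ∀ k, k ≠ 2 → H.val k (update p 2 1) = H'.val k (update p 2 0) := by
    intro p hp k hk
    rw [eq_vec_three p, update_vec_three_two, update_vec_three_two]
    have e := h1 _ (mem_cube_iff.1 hp 0) _ (mem_cube_iff.1 hp 1)
    have e' := h0' _ (mem_cube_iff.1 hp 0) _ (mem_cube_iff.1 hp 1)
    fin_cases k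
    · exact e.1.trans e'.1.symm
    · exact e.2.trans e'.2.symm
    · exact absurd rfl hk
  obtain ⟨K, g1, g2⟩ := CubeMorphism.exists_concat H H' 2 hτ
    (fun p hp => congrArg TotalSpace.proj (hmatch p hp 0 (by simp))) hmatch
  have hK {t s u : ℝ} (ht : t ∈ Icc (0 : ℝ) 1) (hs : s ∈ Icc (0 : ℝ) 1) (hu : u ∈ Icc (0 : ℝ) 1)
      (h : u ≤ 1 / 2) :
      K.val 2 ![t, s, u] = scale (2 * deriv τ (2 * u)) (H.val 2 ![t, s, τ (2 * u)]) ∧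
      ∀ k, k ≠ 2 → K.val k ![t, s, u] = H.val k ![t, s, τ (2 * u)] := by
    have := g1 _ (vec_three_mem_cube ht hs hu) h
    rwa [update_vec_three_two] at this
  have hK' {t s u : ℝ} (ht : t ∈ Icc (0 : ℝ) 1) (hs : s ∈ Icc (0 : ℝ) 1) (hu : u ∈ Icc (0 : ℝ) 1)
      (h : 1 / 2 ≤ u) :
      K.val 2 ![t, s, u] = scale (2 * deriv τ (2 * u - 1)) (H'.val 2 ![t, s, τ (2 * u - 1)]) ∧
      ∀ k, k ≠ 2 → K.val k ![t, s, u] = H'.val k ![t, s, τ (2 * u - 1)] := by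
    have := g2 _ (vec_three_mem_cube ht hs hu) h
    rwa [update_vec_three_two] at this
  have z0 : (0 : ℝ) ∈ Icc (0 : ℝ) 1 := by simp
  have z1 : (1 : ℝ) ∈ Icc (0 : ℝ) 1 := by simp
  refine ⟨K, fun s ms u mu => ?_, fun t mt u mu => ?_, fun t mt s ms => ?_, fun t mt s ms => ?_⟩
  · rcases le_total u (1 / 2) with h | h
    · have e := ht s ms _ (hτ.mem_Icc (2 * u))
      exact ⟨scale_snd_eq_zero (hK z0 ms mu h).1 e.1, scale_snd_eq_zero (hK z1 ms mu h).1 e.2⟩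
    · have e := ht' s ms _ (hτ.mem_Icc (2 * u - 1))
      exact ⟨scale_snd_eq_zero (hK' z0 ms mu h).1 e.1, scale_snd_eq_zero (hK' z1 ms mu h).1 e.2⟩
  · rcases le_total u (1 / 2) with h | h
    · have e := hs t mt _ (hτ.mem_Icc (2 * u))
      exact ⟨scale_snd_eq_zero (hK mt z0 mu h).1 e.1, scale_snd_eq_zero (hK mt z1 mu h).1 e.2⟩
    · have e := hs' t mt _ (hτ.mem_Icc (2 * u - 1))
      exact ⟨scale_snd_eq_zero (hK' mt z0 mu h).1 e.1, scale_snd_eq_zero (hK' mt z1 mu h).1 e.2⟩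
  · have e := (hK mt ms z0 (by norm_num)).2
    rw [hτ.eq_zero _ (by norm_num)] at e
    rw [e 0 (by simp), e 1 (by simp)]
    exact h0 t mt s ms
  · have e := (hK' mt ms z1 (by norm_num)).2
    rw [hτ.eq_one _ (by norm_num)] at e
    rw [e 0 (by simp), e 1 (by simp)]
    exact h1' t mt s ms

end ThreeHomotopies

/-! ### Reparametrization, product and inverse of paths -/

section PathOperations

variable {E : Type*} [NormedAddCommGroup E] [NormedSpace ℝ E]
  {M : Type*} [TopologicalSpace M] [ChartedSpace E M]
  {F : Type*} [NormedAddCommGroup F] [NormedSpace ℝ F]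
  {A : M → Type*} [TopologicalSpace (TotalSpace F A)]
  [∀ x, AddCommGroup (A x)] [∀ x, Module ℝ (A x)] [∀ x, TopologicalSpace (A x)]
  [FiberBundle F A] [VectorBundle ℝ F A]
  [IsManifold 𝓘(ℝ, E) ∞ M] {L : LieAlgebroid E M F A}

lemma scale_zero_eq {x : M} {v : TotalSpace F A} (h : v.1 = x) : scale 0 v = ⟨x, 0⟩ := by
  subst h
  simp [scale]

lemma scale_zero_vector (r : ℝ) (x : M) : scale r (⟨x, 0⟩ : TotalSpace F A) = ⟨x, 0⟩ := by
  simp [scale]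

variable (L) in
/-- The unit path at a point. -/
def unitPath (x : M) : APath L x x where
  base _ := x
  comp _ _ := 0
  smooth _ := contMDiffOn_const
  anchor_eq i p _ := by
    rw [mfderivWithin_const, map_zero]
    rfl
  d_eq i j hij := absurd hij (by rw [Subsingleton.elim i j]; exact lt_irrefl j)
  base_zero := rfl
  base_one := rfl

lemma unitPath_at (x : M) (t : ℝ) : (unitPath L x).at t = ⟨x, 0⟩ := rfl

lemma APath.at_zero_fst {x y : M} (a : APath L x y) : (a.at 0).1 = x := a.base_zero

lemma APath.at_one_fst {x y : M} (a : APath L x y) : (a.at 1).1 = y := a.base_one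

variable [ContMDiffVectorBundle ∞ F A 𝓘(ℝ, E)]
  [FiniteDimensional ℝ E] [FiniteDimensional ℝ F] [T2Space M]

/-- The edges `t = c` of an `A`-homotopy on which `b = 0` are mapped to a point. -/
lemma CubeMorphism.base_eq_of_comp_eq_zero (σ : CubeMorphism L 2) {c : ℝ}
    (hc : c ∈ Icc (0 : ℝ) 1) (h : ∀ s ∈ Icc (0 : ℝ) 1, σ.comp 1 ![c, s] = 0) {s : ℝ}
    (hs : s ∈ Icc (0 : ℝ) 1) : σ.base ![c, s] = σ.base ![c, 0] := by
  let φ (p : Fin 1 → ℝ) : Fin 2 → ℝ := ![c, p 0]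
  let φ' : (Fin 1 → ℝ) →L[ℝ] (Fin 2 → ℝ) :=
    ContinuousLinearMap.pi ![0, ContinuousLinearMap.proj 0]
  have hφ' (p : Fin 1 → ℝ) : HasFDerivAt φ φ' p := by
    rw [hasFDerivAt_pi']
    intro i
    fin_cases i
    · exact hasFDerivAt_const c p
    · exact hasFDerivAt_apply (𝕜 := ℝ) (0 : Fin 1) p
  have hm : MapsTo φ (cube 1) (cube 2) := fun p hp => vec_two_mem_cube hc (mem_cube_iff.1 hp 0)
  have hzero : ∀ p ∈ cube 1, HasMFDerivWithinAt 𝓘(ℝ, Fin 1 → ℝ) 𝓘(ℝ, E) (σ.base ∘ φ) (cube 1) p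
      (0 : (Fin 1 → ℝ) →L[ℝ] E) := by
    intro p hp
    have h1 : HasMFDerivWithinAt 𝓘(ℝ, Fin 1 → ℝ) 𝓘(ℝ, Fin 2 → ℝ) φ (cube 1) p φ' :=
      (hφ' p).hasFDerivWithinAt.hasMFDerivWithinAt
    have h2 := ((σ.contMDiffOn_base 0 _ (hm hp)).mdifferentiableWithinAt
      (by simp)).hasMFDerivWithinAt
    have h3 := h2.comp p h1 hm
    -- By the chain rule the derivative along the edge is the anchor of `b`, which is zero there.
    have h4 : ((mfderivWithin 𝓘(ℝ, Fin 2 → ℝ) 𝓘(ℝ, E) σ.base (cube 2) (φ p) :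
        (Fin 2 → ℝ) →L[ℝ] E).comp φ') = 0 := by
      ext v
      have hv : φ' v = v 0 • (Pi.single 1 1 : Fin 2 → ℝ) := by
        funext k
        fin_cases k <;> simp [φ']
      have ha : L.anchorVal (σ.val 1 (φ p)) = (mfderivWithin 𝓘(ℝ, Fin 2 → ℝ) 𝓘(ℝ, E) σ.base
          (cube 2) (φ p) : (Fin 2 → ℝ) →L[ℝ] E) (Pi.single 1 1) := σ.anchor_eq 1 _ (hm hp)
      have hz : L.anchorVal (σ.val 1 (φ p)) = 0 := by
        change L.anchor (σ.base (φ p)) (σ.comp 1 (φ p)) = 0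
        rw [h _ (mem_cube_iff.1 hp 0), map_zero]
      change (mfderivWithin 𝓘(ℝ, Fin 2 → ℝ) 𝓘(ℝ, E) σ.base
          (cube 2) (φ p) : (Fin 2 → ℝ) →L[ℝ] E) (φ' v) = 0
      rw [hv]
      refine (map_smul (mfderivWithin 𝓘(ℝ, Fin 2 → ℝ) 𝓘(ℝ, E) σ.base
          (cube 2) (φ p) : (Fin 2 → ℝ) →L[ℝ] E) _ _).trans ?_
      rw [← ha, hz]
      exact smul_zero (A := E) (v 0)
    exact h4 ▸ h3
  exact eq_of_hasMFDerivWithinAt_zero (convex_Icc _ _) hzero (vec_one_mem_cube hs)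
    (vec_one_mem_cube (t := 0) (by simp))

/-- The intermediate paths of a homotopy keep their end points. This makes homotopies of composable
paths composable. -/
lemma AHomotopy.base_one {x y : M} {a₀ a₁ : APath L x y} (σ : AHomotopy a₀ a₁) {s : ℝ}
    (hs : s ∈ Icc (0 : ℝ) 1) : σ.base ![1, s] = y := by
  rw [σ.base_eq_of_comp_eq_zero (by simp) σ.b_one hs]
  exact (congrArg TotalSpace.proj (σ.source_eq 1 (by simp))).trans a₀.at_one_fst

lemma AHomotopy.base_zero {x y : M} {a₀ a₁ : APath L x y} (σ : AHomotopy a₀ a₁) {s : ℝ}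
    (hs : s ∈ Icc (0 : ℝ) 1) : σ.base ![0, s] = x := by
  rw [σ.base_eq_of_comp_eq_zero (by simp) σ.b_zero hs]
  exact (congrArg TotalSpace.proj (σ.source_eq 0 (by simp))).trans a₀.at_zero_fst

/-- The reparametrization of an `A`-path by a smooth function. -/
lemma APath.exists_pullsOn {z w : M} (c : APath L z w) {f : ℝ → ℝ} (hf : ContDiff ℝ ∞ f)
    (hm : MapsTo f (Icc 0 1) (Icc 0 1)) {x y : M} (hx : (c.at (f 0)).1 = x)
    (hy : (c.at (f 1)).1 = y) : ∃ a : APath L x y, PullsOn (Icc 0 1) f a c := by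
  have hval (t : ℝ) : (c.reparam 0 f hf hm).val 0 ![t] = scale (deriv f t) (c.at (f t)) := by
    have := c.reparam_val_self 0 hf hm ![t]
    rwa [update_vec_one] at this
  exact ⟨⟨c.reparam 0 f hf hm, (congrArg TotalSpace.proj (hval 0)).trans hx,
    (congrArg TotalSpace.proj (hval 1)).trans hy⟩, fun t _ => hval t⟩

/-- The concatenation of the reparametrizations of two paths by a cut-off function. -/
lemma APath.exists_cat {τ : ℝ → ℝ} (hτ : IsCutoff τ) {x y z : M} (a : APath L x y)
    (b : APath L y z) : ∃ c : APath L x z, PullsOn (Icc 0 (1 / 2)) (fun t => τ (2 * t)) c a ∧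
      PullsOn (Icc (1 / 2) 1) (fun t => τ (2 * t - 1)) c b := by
  obtain ⟨K, h1, h2⟩ := CubeMorphism.exists_concat a.toCubeMorphism b.toCubeMorphism 0 hτ
    (fun p _ => by
      rw [eq_vec_one p, update_vec_one, update_vec_one, a.base_one, b.base_zero])
    fun p _ k hk => absurd (Subsingleton.elim k 0) hk
  have hK {t : ℝ} (ht : t ∈ Icc (0 : ℝ) (1 / 2)) :
      K.val 0 ![t] = scale (deriv (fun t => τ (2 * t)) t) (a.at (τ (2 * t))) := by
    have := (h1 ![t] (vec_one_mem_cube ⟨ht.1, by linarith [ht.2]⟩) ht.2).1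
    rw [update_vec_one] at this
    rw [hτ.deriv_comp_two_mul]
    exact this
  have hK' {t : ℝ} (ht : t ∈ Icc (1 / 2 : ℝ) 1) :
      K.val 0 ![t] = scale (deriv (fun t => τ (2 * t - 1)) t) (b.at (τ (2 * t - 1))) := by
    have := (h2 ![t] (vec_one_mem_cube ⟨by linarith [ht.1], ht.2⟩) ht.1).1
    rw [update_vec_one] at this
    rw [hτ.deriv_comp_affine]
    exact this
  refine ⟨⟨K, ?_, ?_⟩, fun t ht => hK ht, fun t ht => hK' ht⟩
  · refine (congrArg TotalSpace.proj (hK (t := 0) (by norm_num))).trans ?_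
    change (a.at (τ (2 * 0))).1 = x
    rw [hτ.eq_zero _ (by norm_num), a.at_zero_fst]
  · refine (congrArg TotalSpace.proj (hK' (t := 1) (by norm_num))).trans ?_
    change (b.at (τ (2 * 1 - 1))).1 = z
    rw [hτ.eq_one _ (by norm_num), b.at_one_fst]

/-- The concatenation of two paths, after reparametrization by the standard cut-off function. -/
def APath.cat {x y z : M} (a : APath L x y) (b : APath L y z) : APath L x z :=
  (APath.exists_cat isCutoff_smoothTransition a b).choose

lemma APath.cat_left {x y z : M} (a : APath L x y) (b : APath L y z) :
    PullsOn (Icc 0 (1 / 2)) (fun t => Real.smoothTransition (2 * t)) (a.cat b) a :=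
  (APath.exists_cat isCutoff_smoothTransition a b).choose_spec.1

lemma APath.cat_right {x y z : M} (a : APath L x y) (b : APath L y z) :
    PullsOn (Icc (1 / 2) 1) (fun t => Real.smoothTransition (2 * t - 1)) (a.cat b) b :=
  (APath.exists_cat isCutoff_smoothTransition a b).choose_spec.2

lemma APath.exists_inverse {x y : M} (a : APath L x y) :
    ∃ b : APath L y x, PullsOn (Icc 0 1) (fun t => 1 - t) b a :=
  a.exists_pullsOn contDiff_one_sub mapsTo_one_sub (by rw [sub_zero, a.at_one_fst])
    (by rw [sub_self, a.at_zero_fst])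

/-- The inverse path. -/
def APath.inverse {x y : M} (a : APath L x y) : APath L y x := a.exists_inverse.choose

lemma APath.isInverse_inverse {x y : M} (a : APath L x y) : IsInverse a a.inverse := by
  intro t ht
  have := a.exists_inverse.choose_spec t ht
  rwa [(hasDerivAt_one_sub t).deriv] at this

/-- Concatenation in the direction of `t`. At the seam the `b`-components match because both vanish,
over the common end point. -/
lemma Homotopic.cat {P : Prop} {x y z : M} {a₀ a₁ : APath L x y} {b₀ b₁ : APath L y z}
    (h : Homotopic P a₀ a₁) (h' : Homotopic P b₀ b₁) :
    Homotopic P (a₀.cat b₀) (a₁.cat b₁) := by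
  obtain ⟨σ, hσ⟩ := h
  obtain ⟨σ', hσ'⟩ := h'
  have hτ := isCutoff_smoothTransition
  have l0 := a₀.cat_left b₀
  have l1 := a₁.cat_left b₁
  have r0 := a₀.cat_right b₀
  have r1 := a₁.cat_right b₁
  set τ := Real.smoothTransition
  have z0 : (0 : ℝ) ∈ Icc (0 : ℝ) 1 := by simp
  have z1 : (1 : ℝ) ∈ Icc (0 : ℝ) 1 := by simp
  have hbase : ∀ p ∈ cube 2, σ.base (update p 0 1) = σ'.base (update p 0 0) := by
    intro p hp
    have hs := mem_cube_iff.1 hp 1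
    rw [eq_vec_two p, update_vec_two_zero, update_vec_two_zero, σ.base_one hs, σ'.base_zero hs]
  obtain ⟨K, h1, h2⟩ := CubeMorphism.exists_concat σ.toCubeMorphism σ'.toCubeMorphism 0 hτ hbase
    fun p hp k hk => by
      obtain rfl : k = 1 := by fin_cases k <;> simp_all
      have hs := mem_cube_iff.1 hp 1
      have e := hbase p hp
      rw [eq_vec_two p, update_vec_two_zero, update_vec_two_zero] at e ⊢
      unfold CubeMorphism.val
      rw [σ.b_one _ hs, σ'.b_zero _ hs, e]
  have hK {t s : ℝ} (ht : t ∈ Icc (0 : ℝ) 1) (hs : s ∈ Icc (0 : ℝ) 1) (h : t ≤ 1 / 2) :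
      K.val 0 ![t, s] = scale (2 * deriv τ (2 * t)) (σ.val 0 ![τ (2 * t), s]) ∧
      K.val 1 ![t, s] = σ.val 1 ![τ (2 * t), s] := by
    have := h1 _ (vec_two_mem_cube ht hs) h
    rw [update_vec_two_zero] at this
    exact ⟨this.1, this.2 1 (by simp)⟩
  have hK' {t s : ℝ} (ht : t ∈ Icc (0 : ℝ) 1) (hs : s ∈ Icc (0 : ℝ) 1) (h : 1 / 2 ≤ t) :
      K.val 0 ![t, s] = scale (2 * deriv τ (2 * t - 1)) (σ'.val 0 ![τ (2 * t - 1), s]) ∧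
      K.val 1 ![t, s] = σ'.val 1 ![τ (2 * t - 1), s] := by
    have := h2 _ (vec_two_mem_cube ht hs) h
    rw [update_vec_two_zero] at this
    exact ⟨this.1, this.2 1 (by simp)⟩
  refine ⟨⟨K, fun t ht => ?_, fun t ht => ?_, fun s hs => ?_, fun s hs => ?_⟩, fun hP p hp => ?_⟩
  · rcases le_total t (1 / 2) with h | h
    · rw [(hK ht z0 h).1, σ.source_eq _ (hτ.mem_Icc _), l0 t ⟨ht.1, h⟩, hτ.deriv_comp_two_mul]
    · rw [(hK' ht z0 h).1, σ'.source_eq _ (hτ.mem_Icc _), r0 t ⟨h, ht.2⟩, hτ.deriv_comp_affine]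
  · rcases le_total t (1 / 2) with h | h
    · rw [(hK ht z1 h).1, σ.target_eq _ (hτ.mem_Icc _), l1 t ⟨ht.1, h⟩, hτ.deriv_comp_two_mul]
    · rw [(hK' ht z1 h).1, σ'.target_eq _ (hτ.mem_Icc _), r1 t ⟨h, ht.2⟩, hτ.deriv_comp_affine]
  · have e := (hK z0 hs (by norm_num)).2
    rw [hτ.eq_zero _ (by norm_num)] at e
    exact scale_snd_eq_zero (e.trans (scale_one _).symm) (σ.b_zero _ hs)
  · have e := (hK' z1 hs (by norm_num)).2
    rw [hτ.eq_one _ (by norm_num)] at e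
    exact scale_snd_eq_zero (e.trans (scale_one _).symm) (σ'.b_one _ hs)
  · have hp' := mem_cube_iff.1 hp
    rw [eq_vec_two p]
    rcases le_total (p 0) (1 / 2) with h | h
    · have := hK (hp' 0) (hp' 1) h
      exact CubeMorphism.wedge_eq_zero this.1 (this.2.trans (scale_one _).symm)
        (hσ hP _ (vec_two_mem_cube (hτ.mem_Icc _) (hp' 1)))
    · have := hK' (hp' 0) (hp' 1) h
      exact CubeMorphism.wedge_eq_zero this.1 (this.2.trans (scale_one _).symm)
        (hσ' hP _ (vec_two_mem_cube (hτ.mem_Icc _) (hp' 1)))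

lemma Homotopic.inverse {P : Prop} {x y : M} {a₀ a₁ : APath L x y} (h : Homotopic P a₀ a₁) :
    Homotopic P a₀.inverse a₁.inverse := by
  obtain ⟨σ, hσ⟩ := h
  let K := σ.reparam 0 (fun t => 1 - t) contDiff_one_sub mapsTo_one_sub
  have hK1 (t s : ℝ) : K.val 1 ![t, s] = σ.val 1 ![1 - t, s] := by
    have := σ.reparam_val_of_ne 0 contDiff_one_sub mapsTo_one_sub ![t, s] (k := 1) (by simp)
    rwa [update_vec_two_zero] at this
  have hK0 (t s : ℝ) : K.val 0 ![t, s] = scale (-1) (σ.val 0 ![1 - t, s]) := by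
    have := σ.reparam_val_self 0 contDiff_one_sub mapsTo_one_sub ![t, s]
    rwa [update_vec_two_zero, (hasDerivAt_one_sub _).deriv] at this
  refine ⟨⟨K, fun t ht => ?_, fun t ht => ?_, fun s hs => ?_, fun s hs => ?_⟩, fun hP p hp => ?_⟩
  · rw [hK0, σ.source_eq _ (mapsTo_one_sub ht), a₀.isInverse_inverse t ht]
  · rw [hK0, σ.target_eq _ (mapsTo_one_sub ht), a₁.isInverse_inverse t ht]
  · have e := hK1 0 s
    rw [sub_zero] at e
    exact scale_snd_eq_zero (e.trans (scale_one _).symm) (σ.b_one _ hs)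
  · have e := hK1 1 s
    rw [sub_self] at e
    exact scale_snd_eq_zero (e.trans (scale_one _).symm) (σ.b_zero _ hs)
  · have hp' := mem_cube_iff.1 hp
    rw [eq_vec_two p]
    exact CubeMorphism.wedge_eq_zero (hK0 _ _) ((hK1 _ _).trans (scale_one _).symm)
      (hσ hP _ (vec_two_mem_cube (mapsTo_one_sub (hp' 0)) (hp' 1)))

end PathOperations

/-! ### The groupoid laws up to thin homotopy -/

section GroupoidLaws

variable {E : Type*} [NormedAddCommGroup E] [NormedSpace ℝ E]
  {M : Type*} [TopologicalSpace M] [ChartedSpace E M]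
  {F : Type*} [NormedAddCommGroup F] [NormedSpace ℝ F]
  {A : M → Type*} [TopologicalSpace (TotalSpace F A)]
  [∀ x, AddCommGroup (A x)] [∀ x, Module ℝ (A x)] [∀ x, TopologicalSpace (A x)]
  [FiberBundle F A] [VectorBundle ℝ F A]
  [IsManifold 𝓘(ℝ, E) ∞ M] {L : LieAlgebroid E M F A} [ContMDiffVectorBundle ∞ F A 𝓘(ℝ, E)]
  [FiniteDimensional ℝ E] [FiniteDimensional ℝ F] [T2Space M]

lemma IsCutoff.hasDerivAt_two_mul {τ : ℝ → ℝ} (hτ : IsCutoff τ) (t : ℝ) :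
    HasDerivAt (fun t => τ (2 * t)) (2 * deriv τ (2 * t)) t := by
  rw [← hτ.deriv_comp_two_mul]
  exact ((hτ.smooth.comp (contDiff_const.mul contDiff_id)).differentiable (by simp) t).hasDerivAt

lemma IsCutoff.hasDerivAt_two_mul_sub_one {τ : ℝ → ℝ} (hτ : IsCutoff τ) (t : ℝ) :
    HasDerivAt (fun t => τ (2 * t - 1)) (2 * deriv τ (2 * t - 1)) t := by
  rw [← hτ.deriv_comp_affine]
  exact ((hτ.smooth.comp ((contDiff_const.mul contDiff_id).sub contDiff_const)).differentiable
    (by simp) t).hasDerivAt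

lemma IsCutoff.contDiff_two_mul {τ : ℝ → ℝ} (hτ : IsCutoff τ) :
    ContDiff ℝ ∞ fun t => τ (2 * t) :=
  hτ.smooth.comp (contDiff_const.mul contDiff_id)

lemma IsCutoff.contDiff_two_mul_sub_one {τ : ℝ → ℝ} (hτ : IsCutoff τ) :
    ContDiff ℝ ∞ fun t => τ (2 * t - 1) :=
  hτ.smooth.comp ((contDiff_const.mul contDiff_id).sub contDiff_const)

lemma pullsOn_id {s : Set ℝ} {x y : M} (a : APath L x y) : PullsOn s id a a := fun t _ => by
  rw [deriv_id, scale_one, id]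

/-- A reparametrization which fixes the end points is homotopic to the path. -/
lemma PullsOn.homotopic {P : Prop} {x y : M} {a c : APath L x y} {f : ℝ → ℝ}
    (h : PullsOn (Icc 0 1) f a c) (hf : ContDiff ℝ ∞ f) (hm : MapsTo f (Icc 0 1) (Icc 0 1))
    (h0 : f 0 = 0) (h1 : f 1 = 1) : Homotopic P a c :=
  homotopic_of_pullsOn c hf contDiff_id hm (mapsTo_id _) h0 h1 h (pullsOn_id c)

/-- Smooth concatenations represent the product. -/
lemma IsConcat.homotopic_cat {P : Prop} {x y z : M} {a : APath L x y} {b : APath L y z}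
    {c : APath L x z} (h : IsConcat a b c) : Homotopic P (a.cat b) c := by
  have hτ := isCutoff_smoothTransition
  have hl := a.cat_left b
  have hr := a.cat_right b
  set τ := Real.smoothTransition
  -- On each half one of the two summands is constant, so `f` runs through the halves of `c` one
  -- after the other, each with the speed of the cut-off.
  let f (t : ℝ) : ℝ := (τ (2 * t) + τ (2 * t - 1)) / 2
  have hd (t : ℝ) : deriv f t = deriv τ (2 * t) + deriv τ (2 * t - 1) := by
    have h : HasDerivAt f _ t :=
      ((hτ.hasDerivAt_two_mul t).add (hτ.hasDerivAt_two_mul_sub_one t)).div_const 2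
    rw [h.deriv]
    ring
  have hp : PullsOn (Icc 0 1) f (a.cat b) c := by
    intro t ht
    rw [hd]
    rcases le_total t (1 / 2) with h' | h'
    · have hz : 2 * t - 1 ≤ 0 := by linarith
      have hf : f t = τ (2 * t) / 2 := by simp only [f, hτ.eq_zero _ hz, add_zero]
      have hm := hτ.mem_Icc (2 * t)
      rw [hl t ⟨ht.1, h'⟩, hτ.deriv_comp_two_mul, hτ.deriv_eq_zero_of_nonpos hz, hf,
        h.1 _ ⟨by linarith [hm.1], by linarith [hm.2]⟩, scale_scale, add_zero, mul_comm (2 : ℝ),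
        mul_div_cancel₀ _ (two_ne_zero' ℝ)]
    · have hz : 1 ≤ 2 * t := by linarith
      have hf : f t = (1 + τ (2 * t - 1)) / 2 := by simp only [f, hτ.eq_one _ hz]
      have hm := hτ.mem_Icc (2 * t - 1)
      have e : 2 * ((1 + τ (2 * t - 1)) / 2) - 1 = τ (2 * t - 1) := by ring
      rw [hr t ⟨h', ht.2⟩, hτ.deriv_comp_affine, hτ.deriv_eq_zero_of_one_le hz, hf,
        h.2 _ ⟨by linarith [hm.1], by linarith [hm.2]⟩, scale_scale, zero_add, mul_comm (2 : ℝ), e]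
  refine hp.homotopic ?_ (fun t _ => ?_) ?_ ?_
  · exact (hτ.contDiff_two_mul.add hτ.contDiff_two_mul_sub_one).div_const 2
  · have h1 := hτ.mem_Icc (2 * t)
    have h2 := hτ.mem_Icc (2 * t - 1)
    change (τ (2 * t) + τ (2 * t - 1)) / 2 ∈ Icc (0 : ℝ) 1
    exact ⟨by linarith [h1.1, h2.1], by linarith [h1.2, h2.2]⟩
  · simp only [f]
    rw [hτ.eq_zero _ (by norm_num), hτ.eq_zero _ (by norm_num)]
    norm_num
  · simp only [f]
    rw [hτ.eq_one _ (by norm_num), hτ.eq_one _ (by norm_num)]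
    norm_num

/-- The product is itself a reparametrization of `a`, by the function `τ (2 * t)` which rests at `1`
on the second half. -/
lemma APath.cat_unitPath_homotopic {P : Prop} {x y : M} (a : APath L x y) :
    Homotopic P (a.cat (unitPath L y)) a := by
  have hτ := isCutoff_smoothTransition
  have hl := a.cat_left (unitPath L y)
  have hr := a.cat_right (unitPath L y)
  set τ := Real.smoothTransition
  have hp : PullsOn (Icc 0 1) (fun t => τ (2 * t)) (a.cat (unitPath L y)) a := by
    intro t ht
    rcases le_total t (1 / 2) with h | h
    · exact hl t ⟨ht.1, h⟩
    · have hz : 1 ≤ 2 * t := by linarith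
      rw [hr t ⟨h, ht.2⟩, unitPath_at, scale_zero_vector, hτ.deriv_comp_two_mul,
        hτ.deriv_eq_zero_of_one_le hz, mul_zero, scale_zero_eq]
      beta_reduce
      rw [hτ.eq_one _ hz, a.at_one_fst]
  exact hp.homotopic hτ.contDiff_two_mul (fun t _ => hτ.mem_Icc _) (hτ.eq_zero _ (by norm_num))
    (hτ.eq_one _ (by norm_num))

lemma APath.unitPath_cat_homotopic {P : Prop} {x y : M} (a : APath L x y) :
    Homotopic P ((unitPath L x).cat a) a := by
  have hτ := isCutoff_smoothTransition
  have hl := (unitPath L x).cat_left a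
  have hr := (unitPath L x).cat_right a
  set τ := Real.smoothTransition
  have hp : PullsOn (Icc 0 1) (fun t => τ (2 * t - 1)) ((unitPath L x).cat a) a := by
    intro t ht
    rcases le_total t (1 / 2) with h | h
    · have hz : 2 * t - 1 ≤ 0 := by linarith
      rw [hl t ⟨ht.1, h⟩, unitPath_at, scale_zero_vector, hτ.deriv_comp_affine,
        hτ.deriv_eq_zero_of_nonpos hz, mul_zero, scale_zero_eq]
      beta_reduce
      rw [hτ.eq_zero _ hz, a.at_zero_fst]
    · exact hr t ⟨h, ht.2⟩
  exact hp.homotopic hτ.contDiff_two_mul_sub_one (fun t _ => hτ.mem_Icc _)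
    (hτ.eq_zero _ (by norm_num)) (hτ.eq_one _ (by norm_num))

/-- Both sides are reparametrizations of `a`: the product by a function which goes from `0` to `1`
and back, the unit path by the constant `0`. -/
lemma APath.cat_inverse_homotopic {P : Prop} {x y : M} (a : APath L x y) :
    Homotopic P (a.cat a.inverse) (unitPath L x) := by
  have hτ := isCutoff_smoothTransition
  have hl := a.cat_left a.inverse
  have hr := a.cat_right a.inverse
  set τ := Real.smoothTransition
  let f (t : ℝ) : ℝ := τ (2 * t) - τ (2 * t - 1)
  have hd (t : ℝ) : deriv f t = 2 * deriv τ (2 * t) - 2 * deriv τ (2 * t - 1) :=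
    ((hτ.hasDerivAt_two_mul t).sub (hτ.hasDerivAt_two_mul_sub_one t)).deriv
  have hp : PullsOn (Icc 0 1) f (a.cat a.inverse) a := by
    intro t ht
    rw [hd]
    rcases le_total t (1 / 2) with h' | h'
    · have hz : 2 * t - 1 ≤ 0 := by linarith
      have hf : f t = τ (2 * t) := by simp only [f, hτ.eq_zero _ hz, sub_zero]
      rw [hl t ⟨ht.1, h'⟩, hτ.deriv_comp_two_mul, hτ.deriv_eq_zero_of_nonpos hz, hf, mul_zero,
        sub_zero]
    · have hz : 1 ≤ 2 * t := by linarith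
      have hf : f t = 1 - τ (2 * t - 1) := by simp only [f, hτ.eq_one _ hz]
      rw [hr t ⟨h', ht.2⟩, hτ.deriv_comp_affine, hτ.deriv_eq_zero_of_one_le hz, hf,
        a.isInverse_inverse _ (hτ.mem_Icc _), scale_scale, mul_zero, zero_sub, mul_neg_one]
  refine homotopic_of_pullsOn a (g := fun _ => 0)
    (hτ.contDiff_two_mul.sub hτ.contDiff_two_mul_sub_one) contDiff_const (fun t _ => ?_)
    (fun _ _ => by simp) ?_ ?_ hp fun t _ => ?_
  · have h1 := hτ.mem_Icc (2 * t)
    have h2 := hτ.mem_Icc (2 * t - 1)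
    rcases le_total t (1 / 2) with h' | h'
    · rw [hτ.eq_zero (2 * t - 1) (by linarith), sub_zero]
      exact h1
    · rw [hτ.eq_one (2 * t) (by linarith)]
      exact mapsTo_one_sub h2
  · rw [hτ.eq_zero _ (by norm_num), hτ.eq_zero _ (by norm_num), sub_zero]
  · rw [hτ.eq_one _ (by norm_num), hτ.eq_one _ (by norm_num), sub_self]
  · rw [deriv_const, unitPath_at, scale_zero_eq a.at_zero_fst]

lemma APath.inverse_inverse_homotopic {P : Prop} {x y : M} (a : APath L x y) :
    Homotopic P a.inverse.inverse a := by
  refine homotopic_of_at_eq fun t ht => ?_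
  rw [a.inverse.isInverse_inverse t ht, a.isInverse_inverse _ (mapsTo_one_sub ht), scale_scale,
    sub_sub_cancel]
  norm_num
  exact scale_one _

/-- The reparametrization which relates the two ways to concatenate three paths. -/
def assocMap (t : ℝ) : ℝ := 2 / 3 * t - t ^ 2 + 4 / 3 * t ^ 3

lemma contDiff_assocMap : ContDiff ℝ ∞ assocMap := by
  unfold assocMap
  fun_prop

/-- The difference quotient is `(s + t - 1/2)^2 + (s - t)^2 / 3 + 5 / 12`, which is positive. -/
lemma assocMap_mono : Monotone assocMap := by
  intro s t h
  unfold assocMap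
  nlinarith [mul_nonneg (sub_nonneg.2 h) (sq_nonneg (s + t - 1 / 2)),
    mul_nonneg (sub_nonneg.2 h) (sq_nonneg (s - t)), mul_nonneg (sub_nonneg.2 h) (sq_nonneg s),
    mul_nonneg (sub_nonneg.2 h) (sq_nonneg t)]

/-- The cubic is the interpolation polynomial of these four values. It takes the breaks `1/2`, `3/4`
of `f (g h)` to the breaks `1/4`, `1/2` of `(f g) h`, written in the order of traversal. -/
lemma assocMap_zero : assocMap 0 = 0 := by norm_num [assocMap]

lemma assocMap_half : assocMap (1 / 2) = 1 / 4 := by norm_num [assocMap]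

lemma assocMap_three_quarters : assocMap (3 / 4) = 1 / 2 := by norm_num [assocMap]

lemma assocMap_one : assocMap 1 = 1 := by norm_num [assocMap]

/-- This places the inner break of an iterated product exactly at `1/4`. -/
lemma smoothTransition_half : Real.smoothTransition (1 / 2) = 1 / 2 := by
  have h : 0 < expNegInvGlue (1 / 2) := expNegInvGlue.pos_of_pos (by norm_num)
  unfold Real.smoothTransition
  norm_num at h ⊢
  field_simp
  norm_num

lemma deriv_comp_add_mul {f : ℝ → ℝ} (hf : ContDiff ℝ ∞ f) (a b t : ℝ) :
    deriv (fun t => f (a + b * t)) t = b * deriv f (a + b * t) := by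
  have h1 : HasDerivAt (fun t : ℝ => a + b * t) b t := by
    simpa using ((hasDerivAt_id t).const_mul b).const_add a
  rw [mul_comm]
  exact ((hf.differentiable (by simp) (a + b * t)).hasDerivAt.comp t h1).deriv

/-- The two halves of a path. -/
lemma isConcat_of_pullsOn_affine {x y z x' z' : M} {q : APath L x' z'} {f : ℝ → ℝ}
    (hf : ContDiff ℝ ∞ f) {r b : ℝ} {a₁ : APath L x y} {a₂ : APath L y z} {c : APath L x z}
    (h₁ : PullsOn (Icc 0 1) (fun t => f (r + b / 2 * t)) a₁ q)
    (h₂ : PullsOn (Icc 0 1) (fun t => f ((r + b / 2) + b / 2 * t)) a₂ q)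
    (hc : PullsOn (Icc 0 1) (fun t => f (r + b * t)) c q) : IsConcat a₁ a₂ c := by
  constructor
  · intro t ht
    rw [hc t ⟨ht.1, by linarith [ht.2]⟩, h₁ _ ⟨by linarith [ht.1], by linarith [ht.2]⟩,
      scale_scale, deriv_comp_add_mul hf, deriv_comp_add_mul hf]
    have e : r + b / 2 * (2 * t) = r + b * t := by ring
    beta_reduce
    rw [e]
    congr 1
    ring
  · intro t ht
    rw [hc t ⟨by linarith [ht.1], ht.2⟩, h₂ _ ⟨by linarith [ht.1], by linarith [ht.2]⟩,
      scale_scale, deriv_comp_add_mul hf, deriv_comp_add_mul hf]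
    have e : (r + b / 2) + b / 2 * (2 * t - 1) = r + b * t := by ring
    beta_reduce
    rw [e]
    congr 1
    ring

/-- After reparametrization by `assocMap`, the left product `q` becomes `qT`, the smooth
concatenation of `q₁` and `q₂₃`; the latter is that of `q₂` and `q₃`. The three pieces are
reparametrizations of `f`, `g` and `h` which fix the end points. -/
lemma APath.cat_assoc_homotopic {P : Prop} {w x y z : M} (f : APath L w x) (g : APath L x y)
    (h : APath L y z) : Homotopic P ((f.cat g).cat h) (f.cat (g.cat h)) := by
  have hτ := isCutoff_smoothTransition
  set τ := Real.smoothTransition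
  have hmono : Monotone τ := Real.smoothTransition.monotone
  have hhalf : τ (1 / 2) = 1 / 2 := smoothTransition_half
  have fgl : PullsOn (Icc 0 (1 / 2)) (fun t => τ (2 * t)) (f.cat g) f := f.cat_left g
  have fgr : PullsOn (Icc (1 / 2) 1) (fun t => τ (2 * t - 1)) (f.cat g) g := f.cat_right g
  have ql : PullsOn (Icc 0 (1 / 2)) (fun t => τ (2 * t)) ((f.cat g).cat h) (f.cat g) :=
    (f.cat g).cat_left h
  have qr : PullsOn (Icc (1 / 2) 1) (fun t => τ (2 * t - 1)) ((f.cat g).cat h) h :=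
    (f.cat g).cat_right h
  set q := (f.cat g).cat h
  -- the three parts of the path, as reparametrizations
  have qf : PullsOn (Icc 0 (1 / 4)) (fun t => τ (2 * τ (2 * t))) q f := by
    refine PullsOn.comp (g := fun t => τ (2 * t)) (f := fun t => τ (2 * t))
      (fun t ht => ql t ⟨ht.1, by linarith [ht.2]⟩) fgl hτ.contDiff_two_mul
      hτ.contDiff_two_mul fun t ht => ⟨(hτ.mem_Icc _).1, ?_⟩
    rw [← hhalf]
    exact hmono (by linarith [ht.2])
  have qg : PullsOn (Icc (1 / 4) (1 / 2)) (fun t => τ (2 * τ (2 * t) - 1)) q g := by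
    refine PullsOn.comp (g := fun t => τ (2 * t - 1)) (f := fun t => τ (2 * t))
      (fun t ht => ql t ⟨by linarith [ht.1], ht.2⟩) fgr hτ.contDiff_two_mul
      hτ.contDiff_two_mul_sub_one fun t ht => ⟨?_, (hτ.mem_Icc _).2⟩
    rw [← hhalf]
    exact hmono (by linarith [ht.1])
  have hTs (r b : ℝ) : ContDiff ℝ ∞ fun t => assocMap (r + b * t) :=
    contDiff_assocMap.comp (contDiff_const.add (contDiff_const.mul contDiff_id))
  have hmaps {l u r b : ℝ} (hb : 0 ≤ b) (hl : l = assocMap r) (hu : assocMap (r + b) = u) :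
      MapsTo (fun t => assocMap (r + b * t)) (Icc 0 1) (Icc l u) := by
    intro t ht
    rw [hl, ← hu]
    exact ⟨assocMap_mono (by nlinarith [ht.1]), assocMap_mono (by nlinarith [ht.2])⟩
  have hmaps' {l u r b : ℝ} (hb : 0 ≤ b) (hl : l = assocMap r) (hu : assocMap (r + b) = u)
      (h0 : 0 ≤ l) (h1 : u ≤ 1) :
      MapsTo (fun t => assocMap (r + b * t)) (Icc 0 1) (Icc 0 1) :=
    (hmaps hb hl hu).mono_right (Icc_subset_Icc h0 h1)
  -- the base points
  have bx : (q.at (1 / 4)).1 = x := by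
    rw [qf (1 / 4) (by norm_num)]
    change (f.at (τ (2 * τ (2 * (1 / 4))))).1 = x
    rw [show (2 : ℝ) * (1 / 4) = 1 / 2 by norm_num, hhalf, hτ.eq_one _ (by norm_num), f.at_one_fst]
  have bY : (q.at (1 / 2)).1 = y := by
    rw [qr (1 / 2) (by norm_num)]
    change (h.at (τ (2 * (1 / 2) - 1))).1 = y
    rw [hτ.eq_zero _ (by norm_num), h.at_zero_fst]
  -- the parts
  obtain ⟨qT, hqT⟩ := q.exists_pullsOn (hTs 0 1)
    (hmaps' (l := 0) (u := 1) (by norm_num) assocMap_zero.symm (by simp [assocMap_one]) le_rfl le_rfl)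
    (x := w) (y := z) (by simp [assocMap_zero, q.at_zero_fst]) (by simp [assocMap_one, q.at_one_fst])
  obtain ⟨q₁, hq₁⟩ := q.exists_pullsOn (hTs 0 (1 / 2))
    (hmaps' (l := 0) (u := 1 / 4) (by norm_num) assocMap_zero.symm
      (by rw [zero_add, assocMap_half]) le_rfl (by norm_num))
    (x := w) (y := x) (by simp [assocMap_zero, q.at_zero_fst])
    (by rw [zero_add, mul_one, assocMap_half, bx])
  obtain ⟨q₂₃, hq₂₃⟩ := q.exists_pullsOn (hTs (1 / 2) (1 / 2))
    (hmaps' (l := 1 / 4) (u := 1) (by norm_num) assocMap_half.symm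
      (by rw [add_halves, assocMap_one]) (by norm_num) le_rfl)
    (x := x) (y := z) (by rw [mul_zero, add_zero, assocMap_half, bx])
    (by rw [mul_one, add_halves, assocMap_one, q.at_one_fst])
  have e34 : (1 / 2 + 1 / 4 : ℝ) = 3 / 4 := by norm_num
  have e1 : (3 / 4 + 1 / 4 : ℝ) = 1 := by norm_num
  have m₂ : MapsTo (fun t => assocMap (1 / 2 + 1 / 4 * t)) (Icc 0 1) (Icc (1 / 4) (1 / 2)) :=
    hmaps (by norm_num) assocMap_half.symm (by rw [e34, assocMap_three_quarters])
  have m₃ : MapsTo (fun t => assocMap (3 / 4 + 1 / 4 * t)) (Icc 0 1) (Icc (1 / 2) 1) :=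
    hmaps (by norm_num) assocMap_three_quarters.symm (by rw [e1, assocMap_one])
  obtain ⟨q₂, hq₂⟩ := q.exists_pullsOn (hTs (1 / 2) (1 / 4))
    (m₂.mono_right (Icc_subset_Icc (by norm_num) (by norm_num)))
    (x := x) (y := y) (by rw [mul_zero, add_zero, assocMap_half, bx])
    (by rw [mul_one, e34, assocMap_three_quarters, bY])
  obtain ⟨q₃, hq₃⟩ := q.exists_pullsOn (hTs (3 / 4) (1 / 4))
    (m₃.mono_right (Icc_subset_Icc (by norm_num) (by norm_num)))
    (x := y) (y := z) (by rw [mul_zero, add_zero, assocMap_three_quarters, bY])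
    (by rw [mul_one, e1, assocMap_one, q.at_one_fst])
  have c₁ : IsConcat q₁ q₂₃ qT :=
    isConcat_of_pullsOn_affine contDiff_assocMap (r := 0) (b := 1) hq₁
      (by simpa only [zero_add] using hq₂₃) hqT
  have c₂ : IsConcat q₂ q₃ q₂₃ := by
    refine isConcat_of_pullsOn_affine contDiff_assocMap (r := 1 / 2) (b := 1 / 2) ?_ ?_ hq₂₃
    · rw [show (1 / 2 / 2 : ℝ) = 1 / 4 by norm_num]
      exact hq₂
    · rw [show (1 / 2 / 2 : ℝ) = 1 / 4 by norm_num, e34]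
      exact hq₃
  have h₁ : Homotopic P q₁ f := by
    refine (hq₁.comp qf (hTs _ _) (hτ.contDiff_two_mul.comp hτ.contDiff_two_mul)
      (hmaps (by norm_num) assocMap_zero.symm (by rw [zero_add, assocMap_half]))).homotopic
      ((hτ.contDiff_two_mul.comp hτ.contDiff_two_mul).comp (hTs _ _)) (fun t _ => hτ.mem_Icc _)
      ?_ ?_
    · simp only [mul_zero, add_zero, assocMap_zero, hτ.eq_zero 0 le_rfl]
    · rw [zero_add, mul_one, assocMap_half, show (2 : ℝ) * (1 / 4) = 1 / 2 by norm_num, hhalf,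
        hτ.eq_one _ (by norm_num)]
  have h₂ : Homotopic P q₂ g := by
    refine (hq₂.comp qg (hTs _ _) (hτ.contDiff_two_mul_sub_one.comp hτ.contDiff_two_mul)
      m₂).homotopic ((hτ.contDiff_two_mul_sub_one.comp hτ.contDiff_two_mul).comp (hTs _ _))
      (fun t _ => hτ.mem_Icc _) ?_ ?_
    · rw [mul_zero, add_zero, assocMap_half, show (2 : ℝ) * (1 / 4) = 1 / 2 by norm_num, hhalf,
        hτ.eq_zero _ (by norm_num)]
    · rw [mul_one, e34, assocMap_three_quarters, hτ.eq_one (2 * (1 / 2)) (by norm_num),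
        hτ.eq_one _ (by norm_num)]
  have h₃ : Homotopic P q₃ h := by
    refine (hq₃.comp qr (hTs _ _) hτ.contDiff_two_mul_sub_one m₃).homotopic
      (hτ.contDiff_two_mul_sub_one.comp (hTs _ _)) (fun t _ => hτ.mem_Icc _) ?_ ?_
    · rw [mul_zero, add_zero, assocMap_three_quarters, hτ.eq_zero _ (by norm_num)]
    · rw [mul_one, e1, assocMap_one, hτ.eq_one _ (by norm_num)]
  have hT : Homotopic P qT q := by
    refine hqT.homotopic (hTs 0 1) (hmaps (by norm_num) assocMap_zero.symm
      (by rw [zero_add, assocMap_one])) ?_ ?_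
    · rw [mul_zero, add_zero, assocMap_zero]
    · rw [mul_one, zero_add, assocMap_one]
  exact (hT.symm.trans c₁.homotopic_cat.symm).trans
    (h₁.cat (c₂.homotopic_cat.symm.trans (h₂.cat h₃)))

end GroupoidLaws

/-! ### Transport of groupoid structures -/

/-- The groupoid structure obtained from another one by a family of bijections. -/
def GroupoidOver.transport {M : Type*} {Hom Hom' : M → M → Type*} (S : GroupoidOver Hom')
    (φ : ∀ x y, Hom x y ≃ Hom' x y) : GroupoidOver Hom where
  one x := (φ x x).symm (S.one x)
  comp g f := (φ _ _).symm (S.comp (φ _ _ g) (φ _ _ f))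
  inv f := (φ _ _).symm (S.inv (φ _ _ f))
  assoc h g f := by simp only [Equiv.apply_symm_apply, S.assoc]
  one_comp f := by simp only [Equiv.apply_symm_apply, S.one_comp, Equiv.symm_apply_apply]
  comp_one f := by simp only [Equiv.apply_symm_apply, S.comp_one, Equiv.symm_apply_apply]
  inv_comp f := by simp only [Equiv.apply_symm_apply, S.inv_comp]
  comp_inv f := by simp only [Equiv.apply_symm_apply, S.comp_inv]

lemma GroupoidOver.transport_isMorphism {M : Type*} {Hom Hom' : M → M → Type*}
    (S : GroupoidOver Hom') (φ : ∀ x y, Hom x y ≃ Hom' x y) :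
    (S.transport φ).IsMorphism S (fun x y => φ x y) where
  map_one _ := Equiv.apply_symm_apply _ _
  map_comp _ _ := Equiv.apply_symm_apply _ _
  map_inv _ := Equiv.apply_symm_apply _ _

/-! ### The groupoids of classes and the truncation -/

section PathGroupoid

variable {E : Type*} [NormedAddCommGroup E] [NormedSpace ℝ E]
  {M : Type*} [TopologicalSpace M] [ChartedSpace E M]
  {F : Type*} [NormedAddCommGroup F] [NormedSpace ℝ F]
  {A : M → Type*} [TopologicalSpace (TotalSpace F A)]
  [∀ x, AddCommGroup (A x)] [∀ x, Module ℝ (A x)] [∀ x, TopologicalSpace (A x)]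
  [FiberBundle F A] [VectorBundle ℝ F A]
  [IsManifold 𝓘(ℝ, E) ∞ M] {L : LieAlgebroid E M F A} [ContMDiffVectorBundle ∞ F A 𝓘(ℝ, E)]
  [FiniteDimensional ℝ E] [FiniteDimensional ℝ F] [T2Space M]

/-- The groupoid of classes of `A`-paths, with respect to thin or to arbitrary homotopies. -/
def pathGroupoid {P : Prop} {R : ∀ x y : M, APath L x y → APath L x y → Prop}
    (hR : ∀ {x y : M} {a b : APath L x y}, R x y a b ↔ Homotopic P a b) :
    GroupoidOver (fun x y => Quot (R x y)) where
  one x := Quot.mk _ (unitPath L x)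
  comp := Quot.map₂ (fun b a => a.cat b)
    (fun b _ _ h => hR.2 ((hR.1 h).cat (Homotopic.refl b)))
    fun _ _ a h => hR.2 ((Homotopic.refl a).cat (hR.1 h))
  inv := Quot.map APath.inverse fun _ _ h => hR.2 (hR.1 h).inverse
  assoc := by
    rintro w x y z ⟨h⟩ ⟨g⟩ ⟨f⟩
    exact Quot.sound (hR.2 (f.cat_assoc_homotopic g h).symm)
  one_comp := by
    rintro x y ⟨a⟩
    exact Quot.sound (hR.2 a.cat_unitPath_homotopic)
  comp_one := by
    rintro x y ⟨a⟩
    exact Quot.sound (hR.2 a.unitPath_cat_homotopic)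
  inv_comp := by
    rintro x y ⟨a⟩
    exact Quot.sound (hR.2 a.cat_inverse_homotopic)
  comp_inv := by
    rintro x y ⟨a⟩
    -- The other inverse law, applied to `a.inverse`, once `a` is replaced by its double inverse.
    exact Quot.sound (hR.2 (((Homotopic.refl a.inverse).cat a.inverse_inverse_homotopic.symm).trans
      a.inverse.cat_inverse_homotopic))

lemma pathGroupoid_isConcatenationStructure {P : Prop}
    {R : ∀ x y : M, APath L x y → APath L x y → Prop}
    (hR : ∀ {x y : M} {a b : APath L x y}, R x y a b ↔ Homotopic P a b) :
    IsConcatenationStructure (pathGroupoid hR) (fun x y a => Quot.mk (R x y) a) where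
  one_eq x := ⟨unitPath L x, fun t _ => unitPath_at x t, rfl⟩
  inv_eq a := ⟨a.inverse, a.isInverse_inverse, rfl⟩
  comp_eq a b c h := Quot.sound (hR.2 h.homotopic_cat)
  comp_reparam τ hτ {x y z} a b := by
    have h0 := hτ.eq_zero 0 le_rfl
    have h1 := hτ.eq_one 1 le_rfl
    have hm : MapsTo τ (Icc 0 1) (Icc 0 1) := fun t _ => hτ.mem_Icc t
    obtain ⟨a', ha'⟩ := a.exists_pullsOn (x := x) (y := y) hτ.smooth hm
      (by rw [h0]; exact a.at_zero_fst) (by rw [h1]; exact a.at_one_fst)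
    obtain ⟨b', hb'⟩ := b.exists_pullsOn (x := y) (y := z) hτ.smooth hm
      (by rw [h0]; exact b.at_zero_fst) (by rw [h1]; exact b.at_one_fst)
    -- With the given `τ` this path is literally the concatenation of `a'` and `b'`, whereas the
    -- product in the groupoid uses the standard cut-off.
    obtain ⟨c, hl, hr⟩ := APath.exists_cat hτ a b
    have hc : IsConcat a' b' c := by
      constructor
      · intro t ht
        rw [hl t ht, ha' _ ⟨by linarith [ht.1], by linarith [ht.2]⟩, hτ.deriv_comp_two_mul,
          scale_scale]
      · intro t ht
        rw [hr t ht, hb' _ ⟨by linarith [ht.1], by linarith [ht.2]⟩, hτ.deriv_comp_affine,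
          scale_scale]
    refine ⟨a', b', c, ha', hb', hc, Quot.sound (hR.2 ?_)⟩
    exact ((ha'.homotopic hτ.smooth hm h0 h1).symm.cat
      (hb'.homotopic hτ.smooth hm h0 h1).symm).trans hc.homotopic_cat

lemma thinHomotopic_equivalence (x y : M) :
    Equivalence (ThinHomotopic L (x := x) (y := y)) :=
  ⟨fun a => homotopic_true_iff.1 (Homotopic.refl a),
    fun h => homotopic_true_iff.1 (homotopic_true_iff.2 h).symm,
    fun h h' => homotopic_true_iff.1 ((homotopic_true_iff.2 h).trans (homotopic_true_iff.2 h'))⟩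

lemma aHomotopic_equivalence (x y : M) :
    Equivalence (AHomotopic L (x := x) (y := y)) :=
  ⟨fun a => homotopic_false_iff.1 (Homotopic.refl a),
    fun h => homotopic_false_iff.1 (homotopic_false_iff.2 h).symm,
    fun h h' => homotopic_false_iff.1 ((homotopic_false_iff.2 h).trans (homotopic_false_iff.2 h'))⟩

lemma threeHomotopic_equivalence (x y : M) :
    Equivalence (ThreeHomotopic L (x := x) (y := y)) :=
  ⟨ThreeHomotopic.refl, ThreeHomotopic.symm, ThreeHomotopic.trans⟩

lemma ThinHomotopic.aHomotopic {x y : M} {a b : APath L x y} (h : ThinHomotopic L a b) :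
    AHomotopic L a b := ⟨h.choose⟩

/-- There is a 2-morphism between the classes of two paths if and only if the paths are
`A`-homotopic. -/
lemma related_mk_iff {x y : M} {a b : APath L x y} :
    P₂.Related L (P₁.mk a) (P₁.mk b) ↔ AHomotopic L a b := by
  constructor
  · rintro ⟨⟨⟨a', b', σ⟩⟩, ha, hb⟩
    -- The ends of a 2-morphism are known only as thin classes; because thin homotopy is an
    -- equivalence relation, equal classes give actual thin homotopies.
    have e := thinHomotopic_equivalence (L := L) x y
    have ha' : ThinHomotopic L a' a := e.quot_mk_eq_iff _ _ |>.1 ha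
    have hb' : ThinHomotopic L b' b := e.quot_mk_eq_iff _ _ |>.1 hb
    have e' := aHomotopic_equivalence (L := L) x y
    exact e'.trans (e'.symm ha'.aHomotopic) (e'.trans ⟨σ⟩ hb'.aHomotopic)
  · rintro ⟨σ⟩
    exact ⟨Quot.mk _ ⟨a, b, σ⟩, rfl, rfl⟩

lemma related_equivalence (x y : M) : Equivalence (P₂.Related L (x := x) (y := y)) where
  refl := by
    rintro ⟨a⟩
    exact related_mk_iff.2 ((aHomotopic_equivalence x y).refl a)
  symm := by
    rintro ⟨a⟩ ⟨b⟩ h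
    exact related_mk_iff.2 ((aHomotopic_equivalence x y).symm (related_mk_iff.1 h))
  trans := by
    rintro ⟨a⟩ ⟨b⟩ ⟨c⟩ h h'
    exact related_mk_iff.2
      ((aHomotopic_equivalence x y).trans (related_mk_iff.1 h) (related_mk_iff.1 h'))

variable (L) in
/-- The 1-truncation of the Weinstein 2-groupoid is the Weinstein groupoid. -/
def truncationEquiv (x y : M) : Truncation L x y ≃ G L x y where
  toFun := Quot.lift (Quot.lift G.mk fun _ _ h => Quot.sound h.aHomotopic) (by
    rintro ⟨a⟩ ⟨b⟩ h
    exact Quot.sound (related_mk_iff.1 h))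
  invFun := Quot.lift (fun a => Truncation.mk (P₁.mk a)) fun _ _ h =>
    Quot.sound (related_mk_iff.2 h)
  left_inv := by
    rintro ⟨⟨a⟩⟩
    rfl
  right_inv := by
    rintro ⟨a⟩
    rfl

end PathGroupoid

end Weinstein

end

/-! ### The truncation theorem -/

theorem proposition4
    {E : Type*} [NormedAddCommGroup E] [NormedSpace ℝ E] [FiniteDimensional ℝ E]
    {M : Type*} [TopologicalSpace M] [T2Space M] [ChartedSpace E M] [IsManifold 𝓘(ℝ, E) ∞ M]
    {F : Type*} [NormedAddCommGroup F] [NormedSpace ℝ F] [FiniteDimensional ℝ F]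
    {A : M → Type*} [TopologicalSpace (TotalSpace F A)]
    [∀ x, AddCommGroup (A x)] [∀ x, Module ℝ (A x)] [∀ x, TopologicalSpace (A x)]
    [FiberBundle F A] [VectorBundle ℝ F A] [ContMDiffVectorBundle ∞ F A 𝓘(ℝ, E)]
    (L : Weinstein.LieAlgebroid E M F A) :
    (∀ x y : M,
      Equivalence (Weinstein.ThinHomotopic L (x := x) (y := y)) ∧
      Equivalence (Weinstein.AHomotopic L (x := x) (y := y)) ∧
      Equivalence (Weinstein.ThreeHomotopic L (x := x) (y := y)) ∧
      Equivalence (Weinstein.P₂.Related L (x := x) (y := y))) ∧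
    ∃ (S : Weinstein.GroupoidOver (Weinstein.P₁ L))
      (T : Weinstein.GroupoidOver (Weinstein.Truncation L))
      (W : Weinstein.GroupoidOver (Weinstein.G L)),
      Weinstein.IsConcatenationStructure S (fun _ _ a => Weinstein.P₁.mk a) ∧
      S.IsMorphism T (fun _ _ α => Weinstein.Truncation.mk α) ∧
      Weinstein.IsConcatenationStructure W (fun _ _ a => Weinstein.G.mk a) ∧
      ∃ Φ : ∀ x y, Weinstein.Truncation L x y ≃ Weinstein.G L x y,
        T.IsMorphism W (fun x y => Φ x y) ∧
        ∀ (x y : M) (a : Weinstein.APath L x y),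
          Φ x y (Weinstein.Truncation.mk (Weinstein.P₁.mk a)) = Weinstein.G.mk a := by
  refine ⟨fun x y => ⟨Weinstein.thinHomotopic_equivalence x y,
    Weinstein.aHomotopic_equivalence x y, Weinstein.threeHomotopic_equivalence x y,
    Weinstein.related_equivalence x y⟩, ?_⟩
  let S : Weinstein.GroupoidOver (Weinstein.P₁ L) :=
    Weinstein.pathGroupoid (R := fun _ _ => Weinstein.ThinHomotopic L)
      Weinstein.homotopic_true_iff.symm
  let W : Weinstein.GroupoidOver (Weinstein.G L) :=
    Weinstein.pathGroupoid (R := fun _ _ => Weinstein.AHomotopic L)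
      Weinstein.homotopic_false_iff.symm
  -- The structure on the truncation is transported from `W`, so `Φ` is an isomorphism by
  -- construction. That it descends from `S` holds by `rfl`, as `S` and `W` use the same operations
  -- on representatives.
  refine ⟨S, W.transport (Weinstein.truncationEquiv L), W,
    Weinstein.pathGroupoid_isConcatenationStructure Weinstein.homotopic_true_iff.symm, ⟨?_, ?_, ?_⟩,
    Weinstein.pathGroupoid_isConcatenationStructure Weinstein.homotopic_false_iff.symm,
    Weinstein.truncationEquiv L, W.transport_isMorphism _, fun _ _ _ => rfl⟩
  · intro x
    rfl
  · rintro x y z ⟨b⟩ ⟨a⟩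
    rfl
  · rintro x y ⟨a⟩
    rfl
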